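/- Let $\mathcal H$ be a separable (possibly finite-dimensional) complex Hilbert space, $X$ a locally compact Hausdorff space with its Borel $\sigma$-algebra, and let $\mathcal S(\mathcal K)$ denote the positive trace-one operators on a Hilbert space $\mathcal K$. Let $\nu$ be a positive operator-valued measure (POVM) on $X$ with values in $\mathcal B(\mathcal H)$, i.e. $\nu(E)\ge 0$ and $\nu$ is ultraweakly countably additive; let $\rho\in\mathcal S(\mathcal H)$ be of full rank (injective), and put $\nu_\rho(E)=\operatorname{tr}(\rho\,\nu(E))$. A quantum random variable is a function $f:X\to\mathcal B(\mathcal H)$ with $x\mapsto\operatorname{tr}(sf(x))$ measurable for all $s\in\mathcal S(\mathcal H)$. Assume that $\nu$ has a Radon–Nikodým derivative $D=\frac{d\nu}{d\nu_\rho}$, i.e. a quantum random variable $D:X\to\mathcal B(\mathcal H)$ whose matrix entries in an orthonormal basis $(e_i)$ are the densities of $E\mapsto\langle\nu(E)e_j,e_i\rangle$ with respect to $\nu_\rho$. Let $\mathcal L_{\mathcal H}$ be the linear span of the positive quantum random variables. For $f\in\mathcal L_{\mathcal H}$ and $s\in\mathcal S(\mathcal H)$ put $f_s=\operatorname{tr}(sD^{1/2}fD^{1/2})$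 and $$\|f\|_1=\inf\Big\{\sup_{s}\int_X (f_1+f_2+f_3+f_4)_s\,d\nu_\rho : f=f_1-f_2+if_3-if_4,\ 0\le f_k\in\mathcal L_{\mathcal H}\Big\}\in[0,\infty],$$ $$\|f\|_{1,dec}=\inf\Big\{\max(\|S_1\|_1,\|S_2\|_1): 0\le S_1,S_2\in\mathcal L_{\mathcal H},\ \begin{bmatrix}S_1(x)&f(x)\\ f(x)^*&S_2(x)\end{bmatrix}\ge 0\ \text{a.e.}\Big\}.$$ $L^1_{\mathcal H}(X,\nu)$ is the space of $f\in\mathcal L_{\mathcal H}$ with $\|f\|_1<\infty$, modulo those with $\|f\|_1=0$. $L^\infty_{\mathcal H}(X,\nu)$ is the space of ($\nu_\rho$-a.e. classes of) quantum random variables $g$ with $\|g\|_\infty=\operatorname{ess\,sup}_{\nu_\rho}\|g(x)\|<\infty$. The same definitions are used for a POVM with values in $\mathcal B(\mathcal H\otimes\mathcal H)$ and a full-rank density operator on the Hilbert space tensor product $\mathcal H\otimes\mathcal H$. **Theorem.** Suppose that $D\in L^\infty_{\mathcal H}(X,\nu)$ and that $D(x)$ is invertible in $\mathcal B(\mathcal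 H)$ for $\nu_\rho$-a.e. $x$. Then there is a POVM $\nu\otimes_{\nu_\rho}\nu$ with values in $\mathcal B(\mathcal H\otimes\mathcal H)$ given by $\operatorname{tr}\big(s\,(\nu\otimes_{\nu_\rho}\nu)(E)\big)=\int_E\operatorname{tr}\big(s\,(D\otimes D)\big)\,d\nu_\rho$ for all Borel $E$ and $s\in\mathcal S(\mathcal H\otimes\mathcal H)$, and it has a Radon–Nikodým derivative, with values in bounded operators, with respect to $\operatorname{tr}\big(\sigma\,(\nu\otimes_{\nu_\rho}\nu)(\cdot)\big)$ for every full-rank $\sigma\in\mathcal S(\mathcal H\otimes\mathcal H)$. If $f\in L^1_{\mathcal H}(X,\nu)$ and $g\in L^\infty_{\mathcal H}(X,\nu)$, then the pointwise tensor product $f\otimes g$ is a well-defined element of $L^1_{\mathcal H\otimes\mathcal H}(X,\nu\otimes_{\nu_\rho}\nu)$ (formed with any full-rank $\sigma$), and $$\|f\otimes g\|_1\le 2\,\|D\|_\infty\,\|f\|_1\,\|g\|_\infty,\qquad \|f\otimes g\|_{1,dec}\le \|D\|_\infty\,\|f\|_{1,dec}\,\|g\|_\infty .$$ -/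

import Mathlib

open MeasureTheory
open scoped ENNReal TensorProduct ComplexOrder InnerProductSpace

noncomputable section

namespace QRV

section Trace

variable {H : Type*} [NormedAddCommGroup H] [InnerProductSpace ℂ H] [CompleteSpace H]

/-- The index set of a fixed orthonormal (Hilbert) basis of `H`. -/
def basisIndex (H : Type*) [NormedAddCommGroup H] [InnerProductSpace ℂ H] [CompleteSpace H] :
    Set H :=
  (exists_hilbertBasis ℂ H).choose

/-- A fixed orthonormal (Hilbert) basis of `H`. -/
def basis (H : Type*) [NormedAddCommGroup H] [InnerProductSpace ℂ H] [CompleteSpace H] :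
    HilbertBasis (basisIndex H) ℂ H :=
  (exists_hilbertBasis ℂ H).choose_spec.choose

/-- The trace `∑ᵢ ⟨T eᵢ, eᵢ⟩` of an operator (meaningful for trace class operators). -/
def trace (T : H →L[ℂ] H) : ℂ :=
  ∑' i, ⟪basis H i, T (basis H i)⟫_ℂ

/-- The density operators of `H`: positive operators of trace one. (The trace being a convergent
sum is part of `trace s = 1`, since a divergent `tsum` is `0`.) -/
def State (H : Type*) [NormedAddCommGroup H] [InnerProductSpace ℂ H] [CompleteSpace H] : Type _ :=
  {s : H →L[ℂ] H // 0 ≤ s ∧ trace s = 1}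

/-- The operator underlying a density operator. -/
def State.op (s : State H) : H →L[ℂ] H := s.1

/-- A density operator is of full rank if it has trivial kernel (equivalently, dense range). -/
def State.FullRank (s : State H) : Prop := Function.Injective s.op

theorem hasSum_norm_inner_sq (x : H) :
    HasSum (fun i => ‖⟪basis H i, x⟫_ℂ‖ ^ 2) (‖x‖ ^ 2) := by
  have h := (basis H).hasSum_inner_mul_inner x x
  have h2 := Complex.hasSum_re h
  have e : (⟪x, x⟫_ℂ).re = ‖x‖ ^ 2 := by
    rw [inner_self_eq_norm_sq_to_K]; norm_cast
  rw [e] at h2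
  convert h2 using 2 with i
  rw [← inner_conj_symm x (basis H i), RCLike.conj_mul]
  norm_cast

theorem hs_prod (T : H →L[ℂ] H) (hT : Summable fun i => ‖T (basis H i)‖ ^ 2) :
    Summable fun p : basisIndex H × basisIndex H => ‖⟪basis H p.2, T (basis H p.1)⟫_ℂ‖ ^ 2 := by
  rw [summable_prod_of_nonneg (fun p => by positivity)]
  refine ⟨fun i => (hasSum_norm_inner_sq (T (basis H i))).summable, ?_⟩
  have e : ∀ i, ∑' j, ‖⟪basis H j, T (basis H i)⟫_ℂ‖ ^ 2 = ‖T (basis H i)‖ ^ 2 :=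
    fun i => (hasSum_norm_inner_sq (T (basis H i))).tsum_eq
  simp only [e]
  exact hT

/-- For positive `s`, `A` with `s` of trace one, `tr (s A) ≥ 0`. -/
theorem trace_mul_nonneg (s : State H) {A : H →L[ℂ] H} (hA : 0 ≤ A) :
    0 ≤ trace (s.op * A) := by
  obtain ⟨s, hs, hs1⟩ := s
  change 0 ≤ trace (s * A)
  set r := CFC.sqrt s with hr
  have hrr : r * r = s := CFC.sqrt_mul_sqrt_self s hs
  have hr0 : r.IsPositive := (ContinuousLinearMap.nonneg_iff_isPositive r).1 (CFC.sqrt_nonneg s)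
  have hAp : A.IsPositive := (ContinuousLinearMap.nonneg_iff_isPositive A).1 hA
  have rs : ∀ x y, ⟪r x, y⟫_ℂ = ⟪x, r y⟫_ℂ := fun x y => hr0.inner_left_eq_inner_right x y
  have As : ∀ x y, ⟪A x, y⟫_ℂ = ⟪x, A y⟫_ℂ := fun x y => hAp.inner_left_eq_inner_right x y
  have hsum : Summable fun i => ⟪basis H i, s (basis H i)⟫_ℂ := by
    by_contra h
    rw [trace, tsum_eq_zero_of_not_summable h] at hs1
    exact zero_ne_one hs1
  have h1 : Summable fun i => ‖r (basis H i)‖ ^ 2 := by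
    have h := (Complex.hasSum_re hsum.hasSum).summable
    convert h using 2 with i
    rw [← hrr, mul_apply_eq_comp, ← rs, inner_self_eq_norm_sq_to_K]
    norm_cast
  have h2 : Summable fun i => ‖(A * r) (basis H i)‖ ^ 2 := by
    refine Summable.of_nonneg_of_le (fun i => by positivity) (fun i => ?_)
      (h1.mul_left (‖A‖ ^ 2))
    rw [← mul_pow]
    gcongr
    exact A.le_opNorm _
  have p1 := hs_prod r h1
  have p2 := hs_prod (A * r) h2
  have hF : Summable fun p : basisIndex H × basisIndex H =>
      ⟪(A * r) (basis H p.1), basis H p.2⟫_ℂ * ⟪basis H p.2, r (basis H p.1)⟫_ℂ := by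
    refine Summable.of_norm_bounded (p1.add p2) (fun p => ?_)
    rw [norm_mul, norm_inner_symm]
    nlinarith [sq_nonneg (‖⟪basis H p.2, r (basis H p.1)⟫_ℂ‖ -
      ‖⟪basis H p.2, (A * r) (basis H p.1)⟫_ℂ‖),
      sq_nonneg (‖⟪basis H p.2, r (basis H p.1)⟫_ℂ‖),
      sq_nonneg ‖⟪basis H p.2, (A * r) (basis H p.1)⟫_ℂ‖]
  have key : trace (s * A) = ∑' j, ⟪(A * r) (basis H j), r (basis H j)⟫_ℂ := by
    have e1 : ∀ j, ⟪(A * r) (basis H j), r (basis H j)⟫_ℂ =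
        ∑' i, ⟪(A * r) (basis H j), basis H i⟫_ℂ * ⟪basis H i, r (basis H j)⟫_ℂ :=
      fun j => ((basis H).tsum_inner_mul_inner _ _).symm
    have e2 : ∀ i, ⟪basis H i, (s * A) (basis H i)⟫_ℂ =
        ∑' j, ⟪(A * r) (basis H j), basis H i⟫_ℂ * ⟪basis H i, r (basis H j)⟫_ℂ := by
      intro i
      rw [← hrr, mul_apply_eq_comp, mul_apply_eq_comp, ← rs,
        ← (basis H).tsum_inner_mul_inner]
      refine tsum_congr fun j => ?_
      rw [mul_comm, mul_apply_eq_comp, As, rs, rs]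
    simp only [trace, e1, e2]
    exact Summable.tsum_comm hF
  rw [key]
  exact tsum_nonneg fun j => hAp.inner_nonneg_left _

end Trace

section Measures

variable {X : Type*} [MeasurableSpace X]
variable {H : Type*} [NormedAddCommGroup H] [InnerProductSpace ℂ H] [CompleteSpace H]

/-- A positive operator-valued measure: positive on measurable sets and ultraweakly countably
additive, i.e. `tr (s ν(⋃ Eₖ)) = ∑ₖ tr (s ν(Eₖ))` for every density operator `s`. -/
structure POVM (X : Type*) [MeasurableSpace X]
    (H : Type*) [NormedAddCommGroup H] [InnerProductSpace ℂ H] [CompleteSpace H] where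
  /-- The operator assigned to a set. -/
  toFun : Set X → (H →L[ℂ] H)
  /-- Junk value `0` off the `σ`-algebra. -/
  not_measurable : ∀ E, ¬ MeasurableSet E → toFun E = 0
  nonneg : ∀ E, MeasurableSet E → 0 ≤ toFun E
  hasSum_iUnion : ∀ E : ℕ → Set X, (∀ k, MeasurableSet (E k)) →
    Pairwise (Function.onFun Disjoint E) →
    ∀ s : State H, HasSum (fun k => trace (s.op * toFun (E k))) (trace (s.op * toFun (⋃ k, E k)))

theorem POVM.trace_empty (ν : POVM X H) (s : State H) : trace (s.op * ν.toFun ∅) = 0 := by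
  have h := ν.hasSum_iUnion (fun _ => ∅) (fun _ => MeasurableSet.empty)
    (fun _ _ _ => by simp [Function.onFun]) s
  exact (summable_const_iff _).1 h.summable

/-- The finite positive measure `ν_ρ(E) = tr (ρ ν(E))`. -/
def POVM.stateMeasure (ν : POVM X H) (ρ : State H) : Measure X :=
  Measure.ofMeasurable (fun E _ => ENNReal.ofReal (trace (ρ.op * ν.toFun E)).re)
    (by simp [ν.trace_empty])
    (by
      intro E hE hd
      have h := Complex.hasSum_re (ν.hasSum_iUnion E hE hd ρ)
      change ENNReal.ofReal _ = _
      rw [← h.tsum_eq]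
      exact ENNReal.ofReal_tsum_of_nonneg
        (fun k => (Complex.nonneg_iff.1 (trace_mul_nonneg ρ (ν.nonneg _ (hE k)))).1) h.summable)

/-- Quantum random variables: `x ↦ tr (s f(x))` is measurable for every density operator `s`. -/
def IsQRV (f : X → (H →L[ℂ] H)) : Prop :=
  ∀ s : State H, Measurable fun x => trace (s.op * f x)

/-- `D` is a version of the Radon-Nikodým derivative `dν/dμ`: an operator-valued quantum random
variable whose matrix entries are the Radon-Nikodým derivatives `dν_{ij}/dμ` of the complex
measures `ν_{ij}(E) = ⟨ν(E) e_j, e_i⟩`. -/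
def IsRNDeriv (ν : POVM X H) (μ : Measure X) (D : X → (H →L[ℂ] H)) : Prop :=
  IsQRV D ∧ ∀ i j,
    Integrable (fun x => ⟪basis H i, D x (basis H j)⟫_ℂ) μ ∧
    ∀ E, MeasurableSet E →
      ⟪basis H i, ν.toFun E (basis H j)⟫_ℂ = ∫ x in E, ⟪basis H i, D x (basis H j)⟫_ℂ ∂μ

/-- `ν` has a Radon-Nikodým derivative with respect to `μ` taking values in bounded operators. -/
def HasRNDeriv (ν : POVM X H) (μ : Measure X) : Prop :=
  ∃ D, IsRNDeriv ν μ D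

open Classical in
/-- The Radon-Nikodým derivative `dν/dμ` (a fixed version; `0` if there is none). -/
def rnDeriv (ν : POVM X H) (μ : Measure X) : X → (H →L[ℂ] H) :=
  if h : HasRNDeriv ν μ then h.choose else 0

/-- The span of the positive quantum random variables. -/
def qrvSpan (X : Type*) [MeasurableSpace X]
    (H : Type*) [NormedAddCommGroup H] [InnerProductSpace ℂ H] [CompleteSpace H] :
    Submodule ℂ (X → (H →L[ℂ] H)) :=
  Submodule.span ℂ {f | IsQRV f ∧ ∀ x, 0 ≤ f x}

/-- The 4-tuples of positive functions `f₁, …, f₄` with `f = f₁ - f₂ + i f₃ - i f₄`. -/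
def Pos (f : X → (H →L[ℂ] H)) : Set (Fin 4 → X → (H →L[ℂ] H)) :=
  {F | (∀ k, F k ∈ qrvSpan X H ∧ ∀ x, 0 ≤ F k x) ∧
    f = F 0 - F 1 + Complex.I • F 2 - Complex.I • F 3}

/-- `f_s(x) = tr (s (dν/dν_ρ)(x)^{1/2} f(x) (dν/dν_ρ)(x)^{1/2})`. -/
def slice (ν : POVM X H) (ρ s : State H) (f : X → (H →L[ℂ] H)) (x : X) : ℂ :=
  trace (s.op * (CFC.sqrt (rnDeriv ν (ν.stateMeasure ρ) x) * f x *
    CFC.sqrt (rnDeriv ν (ν.stateMeasure ρ) x)))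

/-- The seminorm `‖f‖_p = inf_{Pos f} sup_s ‖(f₁ + f₂ + f₃ + f₄)_s‖_{L^p(ν_ρ)}`. -/
def pNorm (ν : POVM X H) (ρ : State H) (p : ℝ≥0∞) (f : X → (H →L[ℂ] H)) : ℝ≥0∞ :=
  ⨅ F ∈ Pos f, ⨆ s : State H,
    eLpNorm (slice ν ρ s (F 0 + F 1 + F 2 + F 3)) p (ν.stateMeasure ρ)

/-- Membership in `L^p_H(X, ν)`, for functions (representatives of classes modulo the functions
of seminorm zero). -/
def MemLpOp (ν : POVM X H) (ρ : State H) (p : ℝ≥0∞) (f : X → (H →L[ℂ] H)) : Prop :=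
  f ∈ qrvSpan X H ∧ pNorm ν ρ p f < ∞

/-- Positivity of the operator matrix `[[S₁, f], [f*, S₂]]` on `H ⊕ H`. -/
def BlockNonneg (S₁ f S₂ : H →L[ℂ] H) : Prop :=
  ∀ ξ η : H, 0 ≤ ⟪ξ, S₁ ξ⟫_ℂ + ⟪ξ, f η⟫_ℂ + ⟪η, ContinuousLinearMap.adjoint f ξ⟫_ℂ + ⟪η, S₂ η⟫_ℂ

/-- The decomposable seminorm `‖f‖_{p,dec}`. -/
def decNorm (ν : POVM X H) (ρ : State H) (p : ℝ≥0∞) (f : X → (H →L[ℂ] H)) : ℝ≥0∞ :=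
  ⨅ S ∈ {S : (X → (H →L[ℂ] H)) × (X → (H →L[ℂ] H)) |
      (S.1 ∈ qrvSpan X H ∧ ∀ x, 0 ≤ S.1 x) ∧ (S.2 ∈ qrvSpan X H ∧ ∀ x, 0 ≤ S.2 x) ∧
      ∀ᵐ x ∂(ν.stateMeasure ρ), BlockNonneg (S.1 x) (f x) (S.2 x)},
    max (pNorm ν ρ p S.1) (pNorm ν ρ p S.2)

/-- The essential supremum `‖g‖_∞` of the operator norm. -/
def supNorm (ν : POVM X H) (ρ : State H) (g : X → (H →L[ℂ] H)) : ℝ≥0∞ :=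
  essSup (fun x => ‖g x‖ₑ) (ν.stateMeasure ρ)

/-- Essentially bounded quantum random variables. -/
def MemLinfOp (ν : POVM X H) (ρ : State H) (g : X → (H →L[ℂ] H)) : Prop :=
  IsQRV g ∧ supNorm ν ρ g < ∞

end Measures

section Tensor

/-- The Hilbert space tensor product. -/
abbrev HTensor (H K : Type*) [NormedAddCommGroup H] [InnerProductSpace ℂ H]
    [NormedAddCommGroup K] [InnerProductSpace ℂ K] : Type _ :=
  UniformSpace.Completion (H ⊗[ℂ] K)

variable {X : Type*} [MeasurableSpace X]
variable {H : Type*} [NormedAddCommGroup H] [InnerProductSpace ℂ H]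
variable {K : Type*} [NormedAddCommGroup K] [InnerProductSpace ℂ K]

/-- The tensor product `A ⊗ B` of bounded operators on the Hilbert space tensor product. -/
def opTensor (A : H →L[ℂ] H) (B : K →L[ℂ] K) : HTensor H K →L[ℂ] HTensor H K :=
  (TensorProduct.mapL A B).completion

/-- The pointwise tensor product of operator-valued functions. -/
def funTensor (f : X → (H →L[ℂ] H)) (g : X → (K →L[ℂ] K)) (x : X) :
    HTensor H K →L[ℂ] HTensor H K :=
  opTensor (f x) (g x)

/-- `τ` is the POVM `ν₁ ⊗_μ ν₂`, i.e. `τ(E) = ∫_E (dν₁/dμ ⊗ dν₂/dμ) dμ I`, the integral being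
defined by pairing with all density operators. -/
def IsTensorPOVM [CompleteSpace H] [CompleteSpace K] (ν₁ : POVM X H) (ν₂ : POVM X K)
    (μ : Measure X) (τ : POVM X (HTensor H K)) : Prop :=
  ∀ s : State (HTensor H K),
    Integrable (fun x => trace (s.op * funTensor (rnDeriv ν₁ μ) (rnDeriv ν₂ μ) x)) μ ∧
    ∀ E, MeasurableSet E → trace (s.op * τ.toFun E) =
      ∫ x in E, trace (s.op * funTensor (rnDeriv ν₁ μ) (rnDeriv ν₂ μ) x) ∂μ

end Tensor

end QRV

end

/-! Write `μ = ν_ρ`. The derivative `D` is bounded, and it is positive a.e. because its weak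
integrals are the positive operators `ν(E)`. Hence `D ⊗ D` is bounded and positive, and its weak
integrals form the POVM `τ` (`IsQRV.exists_povm`). For a state `σ` the measure `tr (σ τ(·))` is `h
μ` with `h = tr (σ (D ⊗ D))`. Invertibility of `D` makes `h` nonzero a.e., so the derivative of `τ`
is `h⁻¹ (D ⊗ D)` (`HasDensity.isRNDeriv`).

The positive square root of this derivative is `h^{-1/2} (√D ⊗ √D)`, so the slice of `F ⊗ G` at `s`
is `h⁻¹ tr (s (√D F √D ⊗ √D G √D))`. Integrating against `h μ` cancels `h`, and the choice of `σ`
disappears (`IsTensorPOVM.eLpNorm_slice_funTensor`). If `F ≥ 0` and `G = c 1` with a scalar `c ≥ 0`,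
the second factor is `c D ≤ c ‖D‖ 1`. What remains is `tr (s (√D F √D ⊗ 1)) = tr (t √D F √D)`, with
`t` the partial trace of `s`. This gives the bound `‖c‖_∞ ‖D‖_∞ sup_t ∫ F_t`
(`IsTensorPOVM.eLpNorm_slice_funTensor_le`).

A general `g` is reduced to scalars: each self-adjoint part `a` is `(‖a‖ + a)/2 - (‖a‖ - a)/2`, so
the four positive parts of `g` add up to a scalar of size at most `2 ‖g‖`. Tensoring with any
decomposition of `f` and regrouping gives a decomposition of `f ⊗ g` whose total is `(∑ F_k) ⊗ c 1`;
this is the source of the factor 2. For the decomposable norm, a pair `S₁, S₂` for `f` yields the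
pair `S₁ ⊗ ‖g‖ 1, S₂ ⊗ ‖g‖ 1` for `f ⊗ g` (`BlockNonneg.opTensor`). There the second factor is
already a positive scalar, so no 2 appears. -/

noncomputable section

namespace QRV

/-! ### Density operators as countable mixtures of vector states -/

section States

variable {H : Type*} [NormedAddCommGroup H] [InnerProductSpace ℂ H]

theorem summable_norm_sq_apply {ι : Type*} {a : ι → H} (ha : Summable fun i => ‖a i‖ ^ 2)
    (A : H →L[ℂ] H) : Summable fun i => ‖A (a i)‖ ^ 2 := by
  refine Summable.of_nonneg_of_le (fun i => by positivity) (fun i => ?_) (ha.mul_left (‖A‖ ^ 2))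
  rw [← mul_pow]
  gcongr
  exact A.le_opNorm _

theorem inner_self_eq_ofReal (x : H) : ⟪x, x⟫_ℂ = ((‖x‖ ^ 2 : ℝ) : ℂ) := by
  rw [inner_self_eq_norm_sq_to_K]; norm_cast

variable [CompleteSpace H]

/-- Parseval's identity summed over two square summable families, with the sums interchanged. -/
theorem hasSum_inner_of_sq_summable {ι : Type*} {a b : ι → H}
    (ha : Summable fun i => ‖a i‖ ^ 2) (hb : Summable fun i => ‖b i‖ ^ 2) :
    HasSum (fun i => ⟪b i, a i⟫_ℂ)
      (∑' k, ∑' i, ⟪b i, basis H k⟫_ℂ * ⟪basis H k, a i⟫_ℂ) := by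
  have hp : ∀ {c : ι → H}, (Summable fun i => ‖c i‖ ^ 2) →
      Summable fun p : ι × basisIndex H => ‖⟪basis H p.2, c p.1⟫_ℂ‖ ^ 2 := by
    intro c hc
    rw [summable_prod_of_nonneg (fun p => by positivity)]
    refine ⟨fun i => (hasSum_norm_inner_sq (c i)).summable, ?_⟩
    simpa only [(hasSum_norm_inner_sq (c _)).tsum_eq] using hc
  have hF : Summable fun p : ι × basisIndex H =>
      ⟪b p.1, basis H p.2⟫_ℂ * ⟪basis H p.2, a p.1⟫_ℂ := by
    refine Summable.of_norm_bounded ((hp ha).add (hp hb)) (fun p => ?_)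
    rw [norm_mul, norm_inner_symm]
    nlinarith [sq_nonneg (‖⟪basis H p.2, a p.1⟫_ℂ‖ - ‖⟪basis H p.2, b p.1⟫_ℂ‖),
      sq_nonneg (‖⟪basis H p.2, a p.1⟫_ℂ‖), sq_nonneg ‖⟪basis H p.2, b p.1⟫_ℂ‖]
  have e1 : ∀ i, ∑' k, ⟪b i, basis H k⟫_ℂ * ⟪basis H k, a i⟫_ℂ = ⟪b i, a i⟫_ℂ :=
    fun i => (basis H).tsum_inner_mul_inner _ _
  have h := hF.hasSum.prod_fiberwise fun i => (hF.prod_factor i).hasSum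
  simp only [e1] at h
  rw [Summable.tsum_comm (f := fun (i : ι) (k : basisIndex H) =>
    ⟪b i, basis H k⟫_ℂ * ⟪basis H k, a i⟫_ℂ) hF, ]
  simp only [e1]
  exact h.summable.hasSum

/-- A density operator is a countable convex combination of vector states. -/
theorem State.exists_hasSum_trace (s : State H) :
    ∃ v : basisIndex H → H, HasSum (fun j => ‖v j‖ ^ 2) 1 ∧
      ∀ A : H →L[ℂ] H, HasSum (fun j => ⟪v j, A (v j)⟫_ℂ) (trace (s.op * A)) := by
  obtain ⟨s, hs, hs1⟩ := s
  set r := CFC.sqrt s with hr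
  have hrr : r * r = s := CFC.sqrt_mul_sqrt_self s hs
  have hr0 : r.IsPositive := (ContinuousLinearMap.nonneg_iff_isPositive r).1 (CFC.sqrt_nonneg s)
  have rs : ∀ x y, ⟪r x, y⟫_ℂ = ⟪x, r y⟫_ℂ := fun x y => hr0.inner_left_eq_inner_right x y
  have hsum : HasSum (fun i => ⟪basis H i, s (basis H i)⟫_ℂ) 1 := by
    by_cases h : Summable fun i => ⟪basis H i, s (basis H i)⟫_ℂ
    · rw [← hs1]; exact h.hasSum
    · rw [trace, tsum_eq_zero_of_not_summable h] at hs1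
      exact absurd hs1 zero_ne_one
  have h1 : HasSum (fun i => ‖r (basis H i)‖ ^ 2) 1 := by
    have h := Complex.hasSum_re hsum
    convert h using 1
    · ext i
      rw [← hrr, mul_apply_eq_comp, ← rs, inner_self_eq_ofReal, Complex.ofReal_re]
    · simp
  -- This is `tr (r r A) = tr (r A r)` for `r = √s`. Writing `⟪v, A v⟫` as `⟪A* v, v⟫` puts it in
  -- the form of a pairing of two square summable families.
  refine ⟨fun j => r (basis H j), h1, fun A => ?_⟩
  have h := hasSum_inner_of_sq_summable h1.summable
    (summable_norm_sq_apply h1.summable (ContinuousLinearMap.adjoint A))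
  simp only [ContinuousLinearMap.adjoint_inner_left] at h
  convert h using 1
  refine tsum_congr fun k => ?_
  change ⟪basis H k, (s * A) (basis H k)⟫_ℂ = _
  rw [← hrr, mul_apply_eq_comp, mul_apply_eq_comp, ← rs, ← (basis H).tsum_inner_mul_inner]
  refine tsum_congr fun j => ?_
  rw [mul_comm, rs, rs]

/-- Countable convex combinations of vector states are given by density operators. -/
theorem exists_state_of_hasSum {ι : Type*} {u : ι → H} (hu : HasSum (fun i => ‖u i‖ ^ 2) 1) :
    ∃ t : State H, ∀ A : H →L[ℂ] H, HasSum (fun i => ⟪u i, A (u i)⟫_ℂ) (trace (t.op * A)) := by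
  -- The density operator is `∑ |uᵢ⟩⟨uᵢ|`, which converges in operator norm because the `i`-th term
  -- has norm `‖uᵢ‖²`.
  have hs : Summable fun i => InnerProductSpace.rankOne ℂ (u i) (u i) := by
    refine Summable.of_norm_bounded hu.summable fun i => ?_
    rw [InnerProductSpace.norm_rankOne, sq]
  set t := ∑' i, InnerProductSpace.rankOne ℂ (u i) (u i) with ht
  have key : ∀ A : H →L[ℂ] H, HasSum (fun i => ⟪u i, A (u i)⟫_ℂ) (trace (t * A)) := by
    intro A
    have h := hasSum_inner_of_sq_summable hu.summable
      (summable_norm_sq_apply hu.summable (ContinuousLinearMap.adjoint A))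
    simp only [ContinuousLinearMap.adjoint_inner_left] at h
    convert h using 1
    refine tsum_congr fun k => ?_
    have h2 : HasSum (fun i => ⟪basis H k, InnerProductSpace.rankOne ℂ (u i) (u i)
        (A (basis H k))⟫_ℂ) ⟪basis H k, t (A (basis H k))⟫_ℂ :=
      (hs.hasSum.mapL (ContinuousLinearMap.apply ℂ H (A (basis H k)))).mapL
        (innerSL ℂ (basis H k))
    rw [mul_apply_eq_comp, ← h2.tsum_eq]
    refine tsum_congr fun i => ?_
    rw [InnerProductSpace.rankOne_apply, inner_smul_right]
  have h0 : 0 ≤ t := tsum_nonneg fun i =>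
    (ContinuousLinearMap.nonneg_iff_isPositive _).2 (InnerProductSpace.isPositive_rankOne_self _)
  have h1 : trace t = 1 := by
    have h := key 1
    rw [mul_one] at h
    refine h.unique ?_
    simp only [one_apply_eq_self, inner_self_eq_ofReal]
    rw [← Complex.ofReal_one]
    exact (Complex.hasSum_ofReal (f := fun i => ‖u i‖ ^ 2)).2 hu
  exact ⟨⟨t, h0, h1⟩, key⟩

theorem State.norm_trace_mul_le (s : State H) (A : H →L[ℂ] H) : ‖trace (s.op * A)‖ ≤ ‖A‖ := by
  obtain ⟨v, hv, h⟩ := s.exists_hasSum_trace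
  rw [← (h A).tsum_eq]
  have hb := hv.mul_left ‖A‖
  rw [mul_one] at hb
  refine tsum_of_norm_bounded hb fun j => ?_
  calc ‖⟪v j, A (v j)⟫_ℂ‖ ≤ ‖v j‖ * ‖A (v j)‖ := norm_inner_le_norm _ _
    _ ≤ ‖v j‖ * (‖A‖ * ‖v j‖) := by gcongr; exact A.le_opNorm _
    _ = ‖A‖ * ‖v j‖ ^ 2 := by ring

/-- Additivity of a `tsum` needs convergence, which the mixture of vector states supplies for every
bounded operator. -/
theorem State.trace_mul_add (s : State H) (A B : H →L[ℂ] H) :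
    trace (s.op * (A + B)) = trace (s.op * A) + trace (s.op * B) := by
  obtain ⟨v, -, h⟩ := s.exists_hasSum_trace
  refine (h _).unique ?_
  simpa [inner_add_right] using (h A).add (h B)

theorem State.trace_mul_smul (s : State H) (c : ℂ) (A : H →L[ℂ] H) :
    trace (s.op * (c • A)) = c * trace (s.op * A) := by
  rw [mul_smul_comm, trace, trace, ← tsum_mul_left]
  simp

theorem State.trace_mul_mono (s : State H) {A B : H →L[ℂ] H} (h : A ≤ B) :
    trace (s.op * A) ≤ trace (s.op * B) := by
  have h1 := trace_mul_nonneg s (sub_nonneg.2 h)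
  have h2 := s.trace_mul_add A (B - A)
  rw [add_sub_cancel] at h2
  rw [h2]
  exact le_add_of_nonneg_right h1

/-- The trace against a state of a positive invertible operator is nonzero. -/
theorem State.trace_mul_ne_zero_of_isUnit (s : State H) {A : H →L[ℂ] H} (hA : 0 ≤ A)
    (hu : IsUnit A) : trace (s.op * A) ≠ 0 := by
  intro h0
  obtain ⟨v, hv, h⟩ := s.exists_hasSum_trace
  have hAp := (ContinuousLinearMap.nonneg_iff_isPositive A).1 hA
  have h1 := h A
  rw [h0, hasSum_zero_iff_of_nonneg (fun j => hAp.inner_nonneg_right _)] at h1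
  have hsq := CFC.sqrt_mul_sqrt_self A hA
  have hrp : (CFC.sqrt A).IsPositive :=
    (ContinuousLinearMap.nonneg_iff_isPositive _).1 (CFC.sqrt_nonneg A)
  obtain ⟨B, -, hB⟩ := isUnit_iff_exists.1 hu
  -- Zero trace kills every `⟪v j, A (v j)⟫ = ‖√A (v j)‖²`, so `A (v j) = 0`, and invertibility
  -- contradicts total mass 1.
  have hz : ∀ j, v j = 0 := by
    intro j
    have h2 : ⟪v j, A (v j)⟫_ℂ = 0 := congrFun h1 j
    rw [← hsq, mul_apply_eq_comp, ← hrp.inner_left_eq_inner_right, inner_self_eq_zero] at h2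
    calc v j = (B * A) (v j) := by rw [hB]; rfl
      _ = 0 := by rw [← hsq]; simp [h2]
  simp only [hz, norm_zero, ne_eq, OfNat.ofNat_ne_zero, not_false_eq_true, zero_pow] at hv
  exact zero_ne_one (hasSum_zero.unique hv)

/-- The vector state of a unit vector. -/
theorem exists_vectorState {u : H} (hu : ‖u‖ = 1) :
    ∃ t : State H, ∀ A : H →L[ℂ] H, trace (t.op * A) = ⟪u, A u⟫_ℂ := by
  have h : HasSum (fun _ : Unit => ‖u‖ ^ 2) 1 := by
    convert hasSum_unique (fun _ : Unit => ‖u‖ ^ 2) using 1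
    simp [hu]
  obtain ⟨t, ht⟩ := exists_state_of_hasSum h
  exact ⟨t, fun A => (ht A).unique (hasSum_unique (fun _ : Unit => ⟪u, A u⟫_ℂ))⟩

end States

/-! ### Operators on the Hilbert space tensor product and the partial trace -/

section TensorOperators

variable {H : Type*} [NormedAddCommGroup H] [InnerProductSpace ℂ H]
variable {K : Type*} [NormedAddCommGroup K] [InnerProductSpace ℂ K]

/-- Continuous linear maps on the Hilbert space tensor product are determined by their values on
elementary tensors. -/
theorem HTensor.clm_ext {F : Type*} [NormedAddCommGroup F] [NormedSpace ℂ F]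
    {A B : HTensor H K →L[ℂ] F}
    (h : ∀ (a : H) (b : K), A ((a ⊗ₜ[ℂ] b : H ⊗[ℂ] K) : HTensor H K) =
      B ((a ⊗ₜ[ℂ] b : H ⊗[ℂ] K) : HTensor H K)) : A = B := by
  ext w
  induction w using UniformSpace.Completion.induction_on with
  | hp => exact isClosed_eq A.continuous B.continuous
  | ih t =>
    induction t using TensorProduct.induction_on with
    | zero => rw [UniformSpace.Completion.coe_zero, map_zero, map_zero]
    | tmul a b => exact h a b
    | add x y hx hy => rw [UniformSpace.Completion.coe_add, map_add, map_add, hx, hy]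

theorem opTensor_coe_tmul (A : H →L[ℂ] H) (B : K →L[ℂ] K) (a : H) (b : K) :
    opTensor A B ((a ⊗ₜ[ℂ] b : H ⊗[ℂ] K) : HTensor H K) =
      ((A a ⊗ₜ[ℂ] B b : H ⊗[ℂ] K) : HTensor H K) := by
  rw [opTensor, ContinuousLinearMap.completion_apply_coe]
  rfl

theorem opTensor_add_left (A A' : H →L[ℂ] H) (B : K →L[ℂ] K) :
    opTensor (A + A') B = opTensor A B + opTensor A' B :=
  HTensor.clm_ext fun a b => by
    simp [opTensor_coe_tmul, TensorProduct.add_tmul, UniformSpace.Completion.coe_add]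

theorem opTensor_add_right (A : H →L[ℂ] H) (B B' : K →L[ℂ] K) :
    opTensor A (B + B') = opTensor A B + opTensor A B' :=
  HTensor.clm_ext fun a b => by
    simp [opTensor_coe_tmul, TensorProduct.tmul_add, UniformSpace.Completion.coe_add]

theorem opTensor_smul_left (c : ℂ) (A : H →L[ℂ] H) (B : K →L[ℂ] K) :
    opTensor (c • A) B = c • opTensor A B :=
  HTensor.clm_ext fun a b => by
    simp [opTensor_coe_tmul, ← TensorProduct.smul_tmul', UniformSpace.Completion.coe_smul]

theorem opTensor_smul_right (c : ℂ) (A : H →L[ℂ] H) (B : K →L[ℂ] K) :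
    opTensor A (c • B) = c • opTensor A B :=
  HTensor.clm_ext fun a b => by
    simp [opTensor_coe_tmul, UniformSpace.Completion.coe_smul]

theorem opTensor_neg_left (A : H →L[ℂ] H) (B : K →L[ℂ] K) :
    opTensor (-A) B = -opTensor A B := by
  simpa using opTensor_smul_left (-1) A B

theorem opTensor_neg_right (A : H →L[ℂ] H) (B : K →L[ℂ] K) :
    opTensor A (-B) = -opTensor A B := by
  simpa using opTensor_smul_right (-1) A B

theorem opTensor_sub_left (A A' : H →L[ℂ] H) (B : K →L[ℂ] K) :
    opTensor (A - A') B = opTensor A B - opTensor A' B := by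
  rw [sub_eq_add_neg, opTensor_add_left, opTensor_neg_left, sub_eq_add_neg]

theorem opTensor_sub_right (A : H →L[ℂ] H) (B B' : K →L[ℂ] K) :
    opTensor A (B - B') = opTensor A B - opTensor A B' := by
  rw [sub_eq_add_neg, opTensor_add_right, opTensor_neg_right, sub_eq_add_neg]

theorem opTensor_zero_right (A : H →L[ℂ] H) : opTensor A (0 : K →L[ℂ] K) = 0 := by
  simpa using opTensor_smul_right 0 A (0 : K →L[ℂ] K)

theorem opTensor_mul (A A' : H →L[ℂ] H) (B B' : K →L[ℂ] K) :
    opTensor (A * A') (B * B') = opTensor A B * opTensor A' B' :=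
  HTensor.clm_ext fun a b => by
    simp [opTensor_coe_tmul]

theorem opTensor_one_one : opTensor (1 : H →L[ℂ] H) (1 : K →L[ℂ] K) = 1 :=
  HTensor.clm_ext fun a b => by
    simp [opTensor_coe_tmul]

theorem norm_opTensor_le (A : H →L[ℂ] H) (B : K →L[ℂ] K) : ‖opTensor A B‖ ≤ ‖A‖ * ‖B‖ := by
  refine ContinuousLinearMap.opNorm_le_bound _ (by positivity) fun w => ?_
  induction w using UniformSpace.Completion.induction_on with
  | hp => exact isClosed_le (by fun_prop) (by fun_prop)
  | ih t =>
    rw [opTensor, ContinuousLinearMap.completion_apply_coe, UniformSpace.Completion.norm_coe,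
      UniformSpace.Completion.norm_coe]
    exact (ContinuousLinearMap.le_opNorm _ _).trans
      (mul_le_mul_of_nonneg_right (TensorProduct.norm_mapL_le A B) (norm_nonneg _))

theorem isUnit_opTensor {A : H →L[ℂ] H} {B : K →L[ℂ] K} (hA : IsUnit A) (hB : IsUnit B) :
    IsUnit (opTensor A B) := by
  obtain ⟨A', h1, h2⟩ := isUnit_iff_exists.1 hA
  obtain ⟨B', h3, h4⟩ := isUnit_iff_exists.1 hB
  refine isUnit_iff_exists.2 ⟨opTensor A' B', ?_, ?_⟩
  · rw [← opTensor_mul, h1, h3, opTensor_one_one]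
  · rw [← opTensor_mul, h2, h4, opTensor_one_one]

theorem inner_coe_tmul (a a' : H) (b b' : K) :
    ⟪((a ⊗ₜ[ℂ] b : H ⊗[ℂ] K) : HTensor H K), ((a' ⊗ₜ[ℂ] b' : H ⊗[ℂ] K) : HTensor H K)⟫_ℂ =
      ⟪a, a'⟫_ℂ * ⟪b, b'⟫_ℂ := by
  rw [UniformSpace.Completion.inner_coe, TensorProduct.inner_tmul]

/-- Vectors of the Hilbert space tensor product are determined by their inner products with
elementary tensors. -/
theorem HTensor.ext_inner {w z : HTensor H K}
    (h : ∀ (a : H) (b : K), ⟪w, ((a ⊗ₜ[ℂ] b : H ⊗[ℂ] K) : HTensor H K)⟫_ℂ =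
      ⟪z, ((a ⊗ₜ[ℂ] b : H ⊗[ℂ] K) : HTensor H K)⟫_ℂ) : w = z := by
  have e : innerSL ℂ w = innerSL ℂ z := HTensor.clm_ext h
  exact ext_inner_right ℂ fun v => DFunLike.congr_fun e v

/-- The map `ξ ↦ ξ ⊗ e`. -/
def tmulRight (H : Type*) [NormedAddCommGroup H] [InnerProductSpace ℂ H] (e : K) :
    H →L[ℂ] HTensor H K :=
  (UniformSpace.Completion.toComplL (𝕜 := ℂ) (E := H ⊗[ℂ] K)).comp
    ((TensorProduct.mkL ℂ H K).flip e)

theorem tmulRight_apply (e : K) (a : H) :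
    tmulRight H e a = ((a ⊗ₜ[ℂ] e : H ⊗[ℂ] K) : HTensor H K) := rfl

/-- The map `η ↦ a ⊗ η`. -/
def tmulLeft (K : Type*) [NormedAddCommGroup K] [InnerProductSpace ℂ K] (a : H) :
    K →L[ℂ] HTensor H K :=
  (UniformSpace.Completion.toComplL (𝕜 := ℂ) (E := H ⊗[ℂ] K)).comp (TensorProduct.mkL ℂ H K a)

theorem tmulLeft_apply (a : H) (e : K) :
    tmulLeft K a e = ((a ⊗ₜ[ℂ] e : H ⊗[ℂ] K) : HTensor H K) := rfl

theorem hilbertBasis_eq_zero {E ι : Type*} [NormedAddCommGroup E] [InnerProductSpace ℂ E]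
    (b : HilbertBasis ι ℂ E) {x : E} (h : ∀ i, ⟪b i, x⟫_ℂ = 0) : x = 0 := by
  have h1 := b.hasSum_repr x
  simp only [b.repr_apply_apply, h, zero_smul] at h1
  exact h1.unique hasSum_zero

section Complete

variable [CompleteSpace H]

theorem adjoint_tmulRight_coe_tmul (e : K) (a : H) (b : K) :
    ContinuousLinearMap.adjoint (tmulRight H e) ((a ⊗ₜ[ℂ] b : H ⊗[ℂ] K) : HTensor H K) =
      ⟪e, b⟫_ℂ • a := by
  refine ext_inner_left ℂ fun x => ?_
  rw [ContinuousLinearMap.adjoint_inner_right, tmulRight_apply, inner_coe_tmul, inner_smul_right,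
    mul_comm]

theorem adjoint_tmulRight_opTensor_one (e : K) (A : H →L[ℂ] H) (w : HTensor H K) :
    ContinuousLinearMap.adjoint (tmulRight H e) (opTensor A 1 w) =
      A (ContinuousLinearMap.adjoint (tmulRight H e) w) := by
  have h : (ContinuousLinearMap.adjoint (tmulRight H e)).comp (opTensor A (1 : K →L[ℂ] K)) =
      A.comp (ContinuousLinearMap.adjoint (tmulRight H e)) :=
    HTensor.clm_ext fun a b => by
      simp [opTensor_coe_tmul, adjoint_tmulRight_coe_tmul]
  exact DFunLike.congr_fun h w

variable [CompleteSpace K]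

theorem adjoint_opTensor (A : H →L[ℂ] H) (B : K →L[ℂ] K) :
    ContinuousLinearMap.adjoint (opTensor A B) =
      opTensor (ContinuousLinearMap.adjoint A) (ContinuousLinearMap.adjoint B) := by
  refine HTensor.clm_ext fun a b => HTensor.ext_inner fun a' b' => ?_
  rw [ContinuousLinearMap.adjoint_inner_left, opTensor_coe_tmul, opTensor_coe_tmul,
    inner_coe_tmul, inner_coe_tmul, ContinuousLinearMap.adjoint_inner_left,
    ContinuousLinearMap.adjoint_inner_left]

/-- `A ⊗ B = (√A ⊗ √B)* (√A ⊗ √B)`. -/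
theorem opTensor_nonneg {A : H →L[ℂ] H} {B : K →L[ℂ] K} (hA : 0 ≤ A) (hB : 0 ≤ B) :
    0 ≤ opTensor A B := by
  have h : opTensor A B = star (opTensor (CFC.sqrt A) (CFC.sqrt B)) *
      opTensor (CFC.sqrt A) (CFC.sqrt B) := by
    rw [ContinuousLinearMap.star_eq_adjoint, adjoint_opTensor,
      ← ContinuousLinearMap.star_eq_adjoint, ← ContinuousLinearMap.star_eq_adjoint,
      (CFC.sqrt_nonneg A).isSelfAdjoint.star_eq, (CFC.sqrt_nonneg B).isSelfAdjoint.star_eq,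
      ← opTensor_mul, CFC.sqrt_mul_sqrt_self A hA, CFC.sqrt_mul_sqrt_self B hB]
  rw [h]
  exact star_mul_self_nonneg (opTensor (CFC.sqrt A) (CFC.sqrt B))

theorem opTensor_mono_right {A : H →L[ℂ] H} (hA : 0 ≤ A) {B B' : K →L[ℂ] K} (h : B ≤ B') :
    opTensor A B ≤ opTensor A B' := by
  rw [← sub_nonneg, ← opTensor_sub_right]
  exact opTensor_nonneg hA (sub_nonneg.2 h)

/-- The tensor products of the vectors of two Hilbert bases form a Hilbert basis. -/
def tensorBasis (H K : Type*) [NormedAddCommGroup H] [InnerProductSpace ℂ H] [CompleteSpace H]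
    [NormedAddCommGroup K] [InnerProductSpace ℂ K] [CompleteSpace K] :
    HilbertBasis (basisIndex K × basisIndex H) ℂ (HTensor H K) :=
  HilbertBasis.mkOfOrthogonalEqBot
    (v := fun p => ((basis H p.2 ⊗ₜ[ℂ] basis K p.1 : H ⊗[ℂ] K) : HTensor H K))
    (by
      classical
      rw [orthonormal_iff_ite]
      rintro ⟨j, i⟩ ⟨j', i'⟩
      rw [inner_coe_tmul, orthonormal_iff_ite.1 (basis H).orthonormal,
        orthonormal_iff_ite.1 (basis K).orthonormal]
      by_cases h1 : i = i' <;> by_cases h2 : j = j' <;> simp [h1, h2])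
    (by
      rw [Submodule.eq_bot_iff]
      intro w hw
      have h0 : ∀ j i, ⟪((basis H i ⊗ₜ[ℂ] basis K j : H ⊗[ℂ] K) : HTensor H K), w⟫_ℂ = 0 :=
        fun j i => (Submodule.mem_orthogonal _ w).1 hw _ (Submodule.subset_span ⟨(j, i), rfl⟩)
      have h1 : ∀ j (a : H), ⟪((a ⊗ₜ[ℂ] basis K j : H ⊗[ℂ] K) : HTensor H K), w⟫_ℂ = 0 := by
        intro j a
        have h : ContinuousLinearMap.adjoint (tmulRight H (basis K j)) w = 0 :=
          hilbertBasis_eq_zero (basis H) fun i => by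
            rw [ContinuousLinearMap.adjoint_inner_right]
            exact h0 j i
        rw [← tmulRight_apply, ← ContinuousLinearMap.adjoint_inner_right, h, inner_zero_right]
      refine HTensor.ext_inner fun a b => ?_
      have h : ContinuousLinearMap.adjoint (tmulLeft K a) w = 0 :=
        hilbertBasis_eq_zero (basis K) fun j => by
          rw [ContinuousLinearMap.adjoint_inner_right]
          exact h1 j a
      rw [← tmulLeft_apply, ← ContinuousLinearMap.adjoint_inner_left, h, inner_zero_left,
        inner_zero_left])

theorem tensorBasis_apply (p : basisIndex K × basisIndex H) :
    tensorBasis H K p = ((basis H p.2 ⊗ₜ[ℂ] basis K p.1 : H ⊗[ℂ] K) : HTensor H K) := by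
  rw [tensorBasis, HilbertBasis.coe_mkOfOrthogonalEqBot]

/-- Parseval's identity along the second tensor factor. -/
theorem hasSum_inner_adjoint_tmulRight (w z : HTensor H K) :
    HasSum (fun j => ⟪ContinuousLinearMap.adjoint (tmulRight H (basis K j)) w,
      ContinuousLinearMap.adjoint (tmulRight H (basis K j)) z⟫_ℂ) ⟪w, z⟫_ℂ := by
  -- Index pairs carry the `K` index first, so each fibre sum is Parseval's identity in `H`.
  refine ((tensorBasis H K).hasSum_inner_mul_inner w z).prod_fiberwise fun j => ?_
  have h := (basis H).hasSum_inner_mul_inner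
    (ContinuousLinearMap.adjoint (tmulRight H (basis K j)) w)
    (ContinuousLinearMap.adjoint (tmulRight H (basis K j)) z)
  simpa only [ContinuousLinearMap.adjoint_inner_left, ContinuousLinearMap.adjoint_inner_right,
    tensorBasis_apply, tmulRight_apply] using h

/-- Along a basis of the second factor, `A ⊗ 1` is a direct sum of copies of `A`. Both the partial
trace and the positivity of tensored block matrices rest on this. -/
theorem hasSum_inner_opTensor_one (A : H →L[ℂ] H) (w z : HTensor H K) :
    HasSum (fun j => ⟪ContinuousLinearMap.adjoint (tmulRight H (basis K j)) w,
      A (ContinuousLinearMap.adjoint (tmulRight H (basis K j)) z)⟫_ℂ)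
      ⟪w, opTensor A 1 z⟫_ℂ := by
  simpa only [adjoint_tmulRight_opTensor_one] using
    hasSum_inner_adjoint_tmulRight w (opTensor A 1 z)

/-- The partial trace of a density operator over the second tensor factor. -/
theorem State.exists_partialTrace (s : State (HTensor H K)) :
    ∃ t : State H, ∀ A : H →L[ℂ] H, trace (t.op * A) = trace (s.op * opTensor A 1) := by
  obtain ⟨v, hv, h⟩ := s.exists_hasSum_trace
  -- If `s` is the mixture of the vectors `v m`, its partial trace is the mixture of their slices
  -- `(1 ⊗ ⟨e_j|) v m`; Parseval preserves the total mass 1.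
  set u : basisIndex (HTensor H K) × basisIndex K → H := fun p =>
    ContinuousLinearMap.adjoint (tmulRight H (basis K p.2)) (v p.1) with hu
  have hj : ∀ m, HasSum (fun j => ‖u (m, j)‖ ^ 2) (‖v m‖ ^ 2) := by
    intro m
    have h1 := hasSum_inner_adjoint_tmulRight (v m) (v m)
    simp only [inner_self_eq_ofReal] at h1
    exact_mod_cast h1
  have hsum : Summable fun p => ‖u p‖ ^ 2 := by
    rw [summable_prod_of_nonneg (fun p => by positivity)]
    refine ⟨fun m => (hj m).summable, ?_⟩
    simpa only [(hj _).tsum_eq] using hv.summable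
  have hone : HasSum (fun p => ‖u p‖ ^ 2) 1 := by
    have h2 := hsum.hasSum.prod_fiberwise hj
    rw [← h2.unique hv]
    exact hsum.hasSum
  obtain ⟨t, ht⟩ := exists_state_of_hasSum hone
  exact ⟨t, fun A => ((ht A).prod_fiberwise fun m =>
    hasSum_inner_opTensor_one A (v m) (v m)).unique (h _)⟩

end Complete

end TensorOperators

/-! ### Separability and countable bases -/

section Separable

theorem separableSpace_of_hilbertBasis {H : Type*} [NormedAddCommGroup H]
    [InnerProductSpace ℂ H] {ι : Type*} [Countable ι] (b : HilbertBasis ι ℂ H) :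
    TopologicalSpace.SeparableSpace H := by
  rw [← TopologicalSpace.isSeparable_univ_iff]
  have h : TopologicalSpace.IsSeparable
      (Submodule.span ℂ (Set.range b) : Set H) :=
    (Set.countable_range b).isSeparable.span
  have h2 := h.closure
  rw [← Submodule.topologicalClosure_coe, b.dense_span] at h2
  exact h2

variable {H : Type*} [NormedAddCommGroup H] [InnerProductSpace ℂ H] [CompleteSpace H]

/-- Distinct basis vectors are at distance `√2`, so the balls of radius `1/2` around them are
disjoint. -/
instance basisIndex_countable [TopologicalSpace.SeparableSpace H] : Countable (basisIndex H) := by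
  refine Pairwise.countable_of_isOpen_disjoint
    (s := fun i : basisIndex H => Metric.ball (basis H i) (1 / 2)) ?_
    (fun i => Metric.isOpen_ball) (fun i => ⟨_, Metric.mem_ball_self (by norm_num)⟩)
  intro i j hij
  refine Metric.ball_disjoint_ball ?_
  have h1 : ‖basis H i - basis H j‖ ^ 2 = 2 := by
    rw [@norm_sub_sq ℂ, (basis H).orthonormal.1 i, (basis H).orthonormal.1 j,
      (basis H).orthonormal.2 hij]
    norm_num
  rw [dist_eq_norm]
  nlinarith [norm_nonneg (basis H i - basis H j)]

instance HTensor.separableSpace [TopologicalSpace.SeparableSpace H] {K : Type*}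
    [NormedAddCommGroup K] [InnerProductSpace ℂ K] [CompleteSpace K]
    [TopologicalSpace.SeparableSpace K] : TopologicalSpace.SeparableSpace (HTensor H K) :=
  separableSpace_of_hilbertBasis (tensorBasis H K)

end Separable

/-! ### Weak measurability and positive decompositions of quantum random variables -/

section Measurability

variable {X : Type*} [MeasurableSpace X]

theorem measurable_of_hasSum {ι E : Type*} [Countable ι] [NormedAddCommGroup E]
    [MeasurableSpace E] [BorelSpace E] [SecondCountableTopology E] {f : ι → X → E} {g : X → E}
    (hf : ∀ i, Measurable (f i)) (h : ∀ x, HasSum (fun i => f i x) (g x)) : Measurable g := by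
  refine measurable_of_tendsto_metrizable' (f := fun (s : Finset ι) x => ∑ i ∈ s, f i x)
    Filter.atTop (fun s => Finset.measurable_fun_sum s fun i _ => hf i) ?_
  rw [tendsto_pi_nhds]
  intro x
  simpa only [HasSum, SummationFilter.unconditional_filter] using h x

theorem isQRV_of_measurable_inner {E : Type*} [NormedAddCommGroup E] [InnerProductSpace ℂ E]
    [CompleteSpace E] [TopologicalSpace.SeparableSpace E] {f : X → (E →L[ℂ] E)}
    (h : ∀ ξ η : E, Measurable fun x => ⟪ξ, f x η⟫_ℂ) : IsQRV f := by
  intro s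
  obtain ⟨v, -, hv⟩ := s.exists_hasSum_trace
  exact measurable_of_hasSum (fun j => h (v j) (v j)) fun x => hv (f x)

variable {H : Type*} [NormedAddCommGroup H] [InnerProductSpace ℂ H] [CompleteSpace H]

theorem IsQRV.measurable_inner_self {f : X → (H →L[ℂ] H)} (hf : IsQRV f) (u : H) :
    Measurable fun x => ⟪u, f x u⟫_ℂ := by
  rcases eq_or_ne u 0 with rfl | hu
  · simp
  have hn : ‖u‖ ≠ 0 := norm_ne_zero_iff.2 hu
  obtain ⟨t, ht⟩ := exists_vectorState (u := ((‖u‖⁻¹ : ℝ) : ℂ) • u) (by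
    rw [norm_smul, Complex.norm_real, norm_inv, norm_norm, inv_mul_cancel₀ hn])
  have h1 := (hf t).const_mul (((‖u‖ ^ 2 : ℝ)) : ℂ)
  convert h1 using 2 with x
  rw [ht, map_smul, inner_smul_left, inner_smul_right, Complex.conj_ofReal, ← mul_assoc,
    ← mul_assoc]
  norm_cast
  rw [show ‖u‖ ^ 2 * ‖u‖⁻¹ * ‖u‖⁻¹ = 1 by field_simp]
  simp

/-- Vector states give the quadratic forms, and polarization gives the other matrix coefficients. -/
theorem IsQRV.measurable_inner {f : X → (H →L[ℂ] H)} (hf : IsQRV f) (ξ η : H) :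
    Measurable fun x => ⟪ξ, f x η⟫_ℂ := by
  have h1 : ∀ u : H, Measurable fun x => ⟪f x u, u⟫_ℂ := fun u => by
    simpa only [Function.comp_def, inner_conj_symm] using
      Complex.continuous_conj.measurable.comp (hf.measurable_inner_self u)
  have h2 : Measurable fun x => ⟪f x η, ξ⟫_ℂ := by
    have e : ∀ x, ⟪f x η, ξ⟫_ℂ = (⟪f x (ξ + η), ξ + η⟫_ℂ - ⟪f x (ξ - η), ξ - η⟫_ℂ +
        Complex.I * ⟪f x (ξ + Complex.I • η), ξ + Complex.I • η⟫_ℂ -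
        Complex.I * ⟪f x (ξ - Complex.I • η), ξ - Complex.I • η⟫_ℂ) / 4 :=
      fun x => inner_map_polarization (f x : H →ₗ[ℂ] H) ξ η
    simp only [e]
    exact ((((h1 _).sub (h1 _)).add ((h1 _).const_mul _)).sub ((h1 _).const_mul _)).div_const _
  simpa only [Function.comp_def, inner_conj_symm] using
    Complex.continuous_conj.measurable.comp h2

theorem IsQRV.add {f g : X → (H →L[ℂ] H)} (hf : IsQRV f) (hg : IsQRV g) :
    IsQRV (f + g) := fun s => by
  simp only [Pi.add_apply, s.trace_mul_add]
  exact (hf s).add (hg s)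

theorem IsQRV.fun_smul {f : X → (H →L[ℂ] H)} (hf : IsQRV f) {c : X → ℂ} (hc : Measurable c) :
    IsQRV fun x => c x • f x := fun s => by
  simp only [s.trace_mul_smul]
  exact hc.mul (hf s)

theorem IsQRV.const_smul {f : X → (H →L[ℂ] H)} (hf : IsQRV f) (c : ℂ) : IsQRV (c • f) :=
  hf.fun_smul measurable_const

theorem IsQRV.sub {f g : X → (H →L[ℂ] H)} (hf : IsQRV f) (hg : IsQRV g) :
    IsQRV (f - g) := by
  rw [sub_eq_add_neg, ← neg_one_smul ℂ g]
  exact hf.add (hg.const_smul _)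

theorem isQRV_const (A : H →L[ℂ] H) : IsQRV fun _ : X => A := fun _ => measurable_const

variable [TopologicalSpace.SeparableSpace H]

/-- Weak measurability may be tested on the entries in a countable Hilbert basis. -/
theorem isQRV_of_hilbertBasis {ι : Type*} [Countable ι] (b : HilbertBasis ι ℂ H)
    {f : X → (H →L[ℂ] H)} (h : ∀ i j, Measurable fun x => ⟪b i, f x (b j)⟫_ℂ) : IsQRV f := by
  have h1 : ∀ (ξ : H) j, Measurable fun x => ⟪ξ, f x (b j)⟫_ℂ := fun ξ j =>
    measurable_of_hasSum (fun i => (h i j).const_mul ⟪ξ, b i⟫_ℂ)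
      fun x => b.hasSum_inner_mul_inner ξ (f x (b j))
  refine isQRV_of_measurable_inner fun ξ η => ?_
  refine measurable_of_hasSum (fun j => (h1 ξ j).mul_const ⟪b j, η⟫_ℂ) fun x => ?_
  simpa only [ContinuousLinearMap.adjoint_inner_left] using
    b.hasSum_inner_mul_inner (ContinuousLinearMap.adjoint (f x) ξ) η

theorem IsQRV.star_apply {f : X → (H →L[ℂ] H)} (hf : IsQRV f) : IsQRV fun x => star (f x) := by
  refine isQRV_of_measurable_inner fun ξ η => ?_
  have h := Complex.continuous_conj.measurable.comp (hf.measurable_inner η ξ)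
  simpa only [Function.comp_def, inner_conj_symm, ContinuousLinearMap.star_eq_adjoint,
    ContinuousLinearMap.adjoint_inner_right] using h

theorem IsQRV.measurable_norm_apply {f : X → (H →L[ℂ] H)} (hf : IsQRV f) (η : H) :
    Measurable fun x => ‖f x η‖ := by
  have h : Measurable fun x => ‖f x η‖ ^ 2 :=
    measurable_of_hasSum (fun i => ((hf.measurable_inner (basis H i) η).norm.pow_const 2))
      fun x => hasSum_norm_inner_sq (f x η)
  simpa [Real.sqrt_sq] using h.sqrt

/-- The condition `‖f x‖ ≤ c` need only be tested on a dense sequence of vectors. -/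
theorem IsQRV.measurable_norm {f : X → (H →L[ℂ] H)} (hf : IsQRV f) :
    Measurable fun x => ‖f x‖ := by
  refine measurable_of_Iic fun c => ?_
  rcases lt_or_ge c 0 with hc | hc
  · convert MeasurableSet.empty
    ext x
    simpa using hc.trans_le (norm_nonneg _)
  have e : (fun x => ‖f x‖) ⁻¹' Set.Iic c =
      ⋂ n, {x | ‖f x (TopologicalSpace.denseSeq H n)‖ ≤ c * ‖TopologicalSpace.denseSeq H n‖} := by
    ext x
    simp only [Set.mem_preimage, Set.mem_Iic, Set.mem_iInter, Set.mem_ofPred_eq]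
    refine ⟨fun h n => (f x).le_of_opNorm_le h _, fun h => ?_⟩
    refine ContinuousLinearMap.opNorm_le_bound _ hc fun η => ?_
    refine (TopologicalSpace.denseRange_denseSeq H).induction_on
      (p := fun η => ‖f x η‖ ≤ c * ‖η‖) η ?_ h
    exact isClosed_le (by fun_prop) (by fun_prop)
  rw [e]
  exact MeasurableSet.iInter fun n =>
    measurableSet_le (hf.measurable_norm_apply _) measurable_const

theorem IsQRV.funTensor {K : Type*} [NormedAddCommGroup K] [InnerProductSpace ℂ K]
    [CompleteSpace K] [TopologicalSpace.SeparableSpace K]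
    {f : X → (H →L[ℂ] H)} {g : X → (K →L[ℂ] K)} (hf : IsQRV f) (hg : IsQRV g) :
    IsQRV (funTensor f g) := by
  refine isQRV_of_hilbertBasis (tensorBasis H K) fun p q => ?_
  simp only [tensorBasis_apply, QRV.funTensor, opTensor_coe_tmul, inner_coe_tmul]
  exact (hf.measurable_inner _ _).mul (hg.measurable_inner _ _)

/-- A self-adjoint quantum random variable `a` is the difference of `(‖a‖ + a) / 2` and
`(‖a‖ - a) / 2`. -/
theorem IsQRV.exists_sub_of_isSelfAdjoint {a : X → (H →L[ℂ] H)} (ha : IsQRV a)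
    (hs : ∀ x, IsSelfAdjoint (a x)) :
    ∃ P N : X → (H →L[ℂ] H), IsQRV P ∧ IsQRV N ∧ (∀ x, 0 ≤ P x) ∧ (∀ x, 0 ≤ N x) ∧
      a = P - N ∧ ∀ x, P x + N x = ((‖a x‖ : ℝ) : ℂ) • 1 := by
  have hn : IsQRV fun x => ((‖a x‖ : ℝ) : ℂ) • (1 : H →L[ℂ] H) :=
    (isQRV_const 1).fun_smul (Complex.measurable_ofReal.comp ha.measurable_norm)
  have half : ∀ {A : H →L[ℂ] H}, 0 ≤ A → 0 ≤ (1 / 2 : ℂ) • A := fun {A} hA => by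
    have h := smul_nonneg (show (0 : ℝ) ≤ 1 / 2 by norm_num) hA
    rw [← Complex.coe_smul] at h
    simpa using h
  have e : ∀ x, algebraMap ℝ (H →L[ℂ] H) ‖a x‖ = ((‖a x‖ : ℝ) : ℂ) • 1 := fun x => by
    rw [Algebra.algebraMap_eq_smul_one, Complex.coe_smul]
  -- Unlike the spectral positive and negative parts, these depend linearly on `a x` and `‖a x‖`.
  -- They are therefore weakly measurable at once, and their sum is a scalar.
  refine ⟨(1 / 2 : ℂ) • ((fun x => ((‖a x‖ : ℝ) : ℂ) • (1 : H →L[ℂ] H)) + a),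
    (1 / 2 : ℂ) • ((fun x => ((‖a x‖ : ℝ) : ℂ) • (1 : H →L[ℂ] H)) - a),
    (hn.add ha).const_smul _, (hn.sub ha).const_smul _, fun x => half ?_, fun x => half ?_,
    ?_, fun x => ?_⟩
  · have h := (hs x).neg_algebraMap_norm_le_self
    rw [e, ← sub_nonneg, sub_neg_eq_add, add_comm] at h
    exact h
  · have h := (hs x).le_algebraMap_norm_self
    rw [e, ← sub_nonneg] at h
    exact h
  · module
  · simp only [Pi.smul_apply, Pi.add_apply, Pi.sub_apply]
    module

/-- Every quantum random variable is a combination `G₀ - G₁ + i G₂ - i G₃` of positive ones with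
`G₀ + G₁ + G₂ + G₃` a scalar function of size at most `2 ‖g‖`. -/
theorem IsQRV.exists_decomp {g : X → (H →L[ℂ] H)} (hg : IsQRV g) :
    ∃ (G : Fin 4 → X → (H →L[ℂ] H)) (c : X → ℝ), (∀ k, IsQRV (G k)) ∧ (∀ k x, 0 ≤ G k x) ∧
      g = G 0 - G 1 + Complex.I • G 2 - Complex.I • G 3 ∧
      (∀ x, 0 ≤ c x) ∧ (∀ x, c x ≤ 2 * ‖g x‖) ∧
      ∀ x, (G 0 + G 1 + G 2 + G 3) x = (c x : ℂ) • (1 : H →L[ℂ] H) := by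
  obtain ⟨P, N, hP, hN, hP0, hN0, h1, h2⟩ := IsQRV.exists_sub_of_isSelfAdjoint
    (a := (1 / 2 : ℂ) • (g + fun x => star (g x))) ((hg.add hg.star_apply).const_smul _) (fun x => by
      simp [IsSelfAdjoint, add_comm])
  obtain ⟨P', N', hP', hN', hP0', hN0', h1', h2'⟩ := IsQRV.exists_sub_of_isSelfAdjoint
    (a := (-Complex.I / 2 : ℂ) • (g - fun x => star (g x))) ((hg.sub hg.star_apply).const_smul _)
    (fun x => by
      simp only [IsSelfAdjoint, Pi.smul_apply, Pi.sub_apply, star_smul, star_sub, star_star,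
        RCLike.star_def, map_div₀, map_neg, Complex.conj_I, map_ofNat]
      module)
  -- The scalar is `‖Re g‖ + ‖Im g‖`, each term being at most `‖g‖`.
  refine ⟨![P, N, P', N'], fun x => ‖((1 / 2 : ℂ) • (g + fun x => star (g x))) x‖ +
    ‖((-Complex.I / 2 : ℂ) • (g - fun x => star (g x))) x‖, ?_, ?_, ?_, ?_, ?_, ?_⟩
  · intro k; fin_cases k <;> assumption
  · intro k; fin_cases k <;> assumption
  · simp only [Matrix.cons_val]
    rw [add_sub_assoc, ← smul_sub, ← h1, ← h1', smul_smul,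
      show Complex.I * (-Complex.I / 2) = 1 / 2 by
        rw [mul_div_assoc', mul_neg, Complex.I_mul_I, neg_neg]]
    module
  · intro x; positivity
  · intro x
    have e1 : ‖((1 / 2 : ℂ) • (g + fun x => star (g x))) x‖ ≤ ‖g x‖ := by
      rw [Pi.smul_apply, norm_smul]
      have := norm_add_le (g x) (star (g x))
      rw [norm_star] at this
      simp only [Pi.add_apply, one_div, norm_inv, Complex.norm_ofNat]
      linarith
    have e2 : ‖((-Complex.I / 2 : ℂ) • (g - fun x => star (g x))) x‖ ≤ ‖g x‖ := by
      rw [Pi.smul_apply, norm_smul]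
      have := norm_sub_le (g x) (star (g x))
      rw [norm_star] at this
      simp only [Pi.sub_apply, norm_div, norm_neg, Complex.norm_I, Complex.norm_ofNat]
      linarith
    linarith
  · intro x
    simp only [Matrix.cons_val, Pi.add_apply]
    rw [add_assoc, h2, h2', Complex.ofReal_add, add_smul]

/-- The positive decomposition shows that the span exhausts all quantum random variables, so
membership becomes weak measurability, which tensor products preserve. -/
theorem mem_qrvSpan_iff {f : X → (H →L[ℂ] H)} : f ∈ qrvSpan X H ↔ IsQRV f := by
  constructor
  · intro h
    induction h using Submodule.span_induction with
    | mem f hf => exact hf.1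
    | zero => exact isQRV_const 0
    | add f g _ _ hf hg => exact hf.add hg
    | smul c f _ hf => exact hf.const_smul c
  · intro h
    obtain ⟨G, -, hG, hG0, e, -⟩ := h.exists_decomp
    have hm : ∀ k, G k ∈ qrvSpan X H := fun k => Submodule.subset_span ⟨hG k, hG0 k⟩
    rw [e]
    exact sub_mem (add_mem (sub_mem (hm 0) (hm 1)) (Submodule.smul_mem _ _ (hm 2)))
      (Submodule.smul_mem _ _ (hm 3))

end Measurability

/-! ### Weak integrals, densities of POVMs and Radon–Nikodým derivatives -/

section OperatorMeasures

variable {X : Type*} [MeasurableSpace X]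

theorem ae_nonneg_of_forall_setIntegral_nonneg_complex {μ : Measure X} {g : X → ℂ}
    (hg : Integrable g μ) (h : ∀ E, MeasurableSet E → 0 ≤ ∫ x in E, g x ∂μ) :
    ∀ᵐ x ∂μ, 0 ≤ g x := by
  have hre : 0 ≤ᵐ[μ] fun x => (g x).re := by
    refine ae_nonneg_of_forall_setIntegral_nonneg hg.re fun E hE _ => ?_
    have e : ∫ x in E, (g x).re ∂μ = (∫ x in E, g x ∂μ).re := integral_re hg.integrableOn
    exact e ▸ (Complex.nonneg_iff.1 (h E hE)).1
  have him : (fun x => (g x).im) =ᵐ[μ] fun _ => 0 := by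
    refine Integrable.ae_eq_of_forall_setIntegral_eq _ _ hg.im (integrable_zero _ _ _)
      fun E hE _ => ?_
    have e : ∫ x in E, (g x).im ∂μ = (∫ x in E, g x ∂μ).im := integral_im hg.integrableOn
    rw [integral_zero]
    exact e ▸ (Complex.nonneg_iff.1 (h E hE)).2.symm
  filter_upwards [hre, him] with x h1 h2
  exact Complex.nonneg_iff.2 ⟨h1, h2.symm⟩

section Hilbert

theorem nonneg_iff_inner {H : Type*} [NormedAddCommGroup H] [InnerProductSpace ℂ H]
    {A : H →L[ℂ] H} : 0 ≤ A ↔ ∀ ξ : H, 0 ≤ ⟪ξ, A ξ⟫_ℂ := by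
  rw [ContinuousLinearMap.nonneg_iff_isPositive]
  refine ⟨fun h ξ => h.inner_nonneg_right ξ, fun h => ?_⟩
  rw [ContinuousLinearMap.isPositive_iff_complex]
  intro ξ
  have h1 := Complex.nonneg_iff.1 (h ξ)
  have e : ⟪A ξ, ξ⟫_ℂ = ⟪ξ, A ξ⟫_ℂ := by
    rw [← inner_conj_symm]
    exact Complex.conj_eq_iff_im.2 h1.2.symm
  rw [e]
  exact ⟨Complex.ext (by simp) (by simpa using h1.2), h1.1⟩

variable {H : Type*} [NormedAddCommGroup H] [InnerProductSpace ℂ H] [CompleteSpace H]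

/-- Density operators separate bounded operators. -/
theorem eq_of_forall_trace_eq {A B : H →L[ℂ] H}
    (h : ∀ s : State H, trace (s.op * A) = trace (s.op * B)) : A = B := by
  have h2 : ∀ u : H, ⟪u, A u⟫_ℂ = ⟪u, B u⟫_ℂ := by
    intro u
    rcases eq_or_ne u 0 with rfl | hu
    · simp
    have hn : ‖u‖ ≠ 0 := norm_ne_zero_iff.2 hu
    obtain ⟨t, ht⟩ := exists_vectorState (u := ((‖u‖⁻¹ : ℝ) : ℂ) • u) (by
      rw [norm_smul, Complex.norm_real, norm_inv, norm_norm, inv_mul_cancel₀ hn])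
    have h3 := h t
    rw [ht, ht, map_smul, map_smul, inner_smul_left, inner_smul_left, inner_smul_right,
      inner_smul_right] at h3
    have hc : ((‖u‖⁻¹ : ℝ) : ℂ) ≠ 0 := by exact_mod_cast inv_ne_zero hn
    exact mul_left_cancel₀ hc (mul_left_cancel₀ ((map_ne_zero _).2 hc) h3)
  have h3 := (ext_inner_map (A : H →ₗ[ℂ] H) (B : H →ₗ[ℂ] H)).1 fun u => by
    rw [← inner_conj_symm, ← inner_conj_symm (B.toLinearMap u) u]
    exact congrArg _ (h2 u)
  exact ContinuousLinearMap.coe_injective h3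

theorem eq_of_inner_basis_eq {ι : Type*} (b : HilbertBasis ι ℂ H) {A B : H →L[ℂ] H}
    (h : ∀ i j, ⟪b i, A (b j)⟫_ℂ = ⟪b i, B (b j)⟫_ℂ) : A = B := by
  have h1 : ∀ j, A (b j) = B (b j) := fun j => by
    rw [← sub_eq_zero]
    exact hilbertBasis_eq_zero b fun i => by rw [inner_sub_right, h, sub_self]
  have h2 : ∀ ξ, ContinuousLinearMap.adjoint A ξ = ContinuousLinearMap.adjoint B ξ := fun ξ => by
    rw [← sub_eq_zero]
    exact hilbertBasis_eq_zero b fun j => by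
      rw [inner_sub_right, ContinuousLinearMap.adjoint_inner_right,
        ContinuousLinearMap.adjoint_inner_right, h1, sub_self]
  exact ContinuousLinearMap.adjoint.injective (ContinuousLinearMap.ext h2)

theorem POVM.stateMeasure_apply (ν : POVM X H) (ρ : State H) {E : Set X} (hE : MeasurableSet E) :
    ν.stateMeasure ρ E = ENNReal.ofReal (trace (ρ.op * ν.toFun E)).re := by
  rw [POVM.stateMeasure, Measure.ofMeasurable_apply _ hE]

instance POVM.isFiniteMeasure_stateMeasure (ν : POVM X H) (ρ : State H) :
    IsFiniteMeasure (ν.stateMeasure ρ) :=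
  ⟨by rw [ν.stateMeasure_apply ρ MeasurableSet.univ]; exact ENNReal.ofReal_lt_top⟩

theorem isRNDeriv_rnDeriv {ν : POVM X H} {μ : Measure X} (h : HasRNDeriv ν μ) :
    IsRNDeriv ν μ (rnDeriv ν μ) := by
  rw [rnDeriv, dif_pos h]
  exact h.choose_spec

/-- `τ` has the weak density `Q` with respect to `μ`. -/
def HasDensity (τ : POVM X H) (μ : Measure X) (Q : X → (H →L[ℂ] H)) : Prop :=
  ∀ (s : State H) (E : Set X), MeasurableSet E →
    trace (s.op * τ.toFun E) = ∫ x in E, trace (s.op * Q x) ∂μ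

variable {μ : Measure X} {f : X → (H →L[ℂ] H)} {C : ℝ}

/-- The scalar density of `E ↦ tr (σ τ(E))` when `τ` has density `Q`. -/
def scalarDensity (σ : State H) (Q : X → (H →L[ℂ] H)) (x : X) : NNReal :=
  (trace (σ.op * Q x)).re.toNNReal

theorem IsQRV.measurable_scalarDensity (hf : IsQRV f) (σ : State H) :
    Measurable (scalarDensity σ f) :=
  (Complex.measurable_re.comp (hf σ)).real_toNNReal

theorem ae_scalarDensity_ne_zero (h0 : ∀ᵐ x ∂μ, 0 ≤ f x) (hu : ∀ᵐ x ∂μ, IsUnit (f x))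
    (σ : State H) : ∀ᵐ x ∂μ, scalarDensity σ f x ≠ 0 := by
  filter_upwards [h0, hu] with x h1 h2
  have h3 := Complex.nonneg_iff.1 (trace_mul_nonneg σ h1)
  have h4 := σ.trace_mul_ne_zero_of_isUnit h1 h2
  have h5 : (trace (σ.op * f x)).re ≠ 0 := fun h => h4 (Complex.ext h h3.2.symm)
  rw [scalarDensity, ne_eq, Real.toNNReal_eq_zero, not_le]
  exact lt_of_le_of_ne h3.1 h5.symm

theorem IsQRV.integrable_trace [IsFiniteMeasure μ] (hf : IsQRV f)
    (hC : ∀ᵐ x ∂μ, ‖f x‖ ≤ C) (s : State H) :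
    Integrable (fun x => trace (s.op * f x)) μ := by
  refine Integrable.of_bound (hf s).aestronglyMeasurable C ?_
  filter_upwards [hC] with x hx
  exact (s.norm_trace_mul_le _).trans hx

theorem HasDensity.stateMeasure_eq [IsFiniteMeasure μ] {τ : POVM X H} (h : HasDensity τ μ f)
    (hf : IsQRV f) (hC : ∀ᵐ x ∂μ, ‖f x‖ ≤ C) (h0 : ∀ᵐ x ∂μ, 0 ≤ f x) (σ : State H) :
    τ.stateMeasure σ = μ.withDensity fun x => (scalarDensity σ f x : ℝ≥0∞) := by
  refine Measure.ext fun E hE => ?_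
  have hi := (hf.integrable_trace hC σ).integrableOn (s := E)
  have e : (∫ x in E, trace (σ.op * f x) ∂μ).re = ∫ x in E, (trace (σ.op * f x)).re ∂μ :=
    (integral_re hi).symm
  rw [τ.stateMeasure_apply σ hE, withDensity_apply _ hE, h σ E hE, e,
    ofReal_integral_eq_lintegral_ofReal (f := fun x => (trace (σ.op * f x)).re) hi.re]
  · rfl
  · refine ae_restrict_of_ae ?_
    filter_upwards [h0] with x hx
    exact (Complex.nonneg_iff.1 (trace_mul_nonneg σ hx)).1

variable [TopologicalSpace.SeparableSpace H]

/-- There are countably many matrix entries, so their exceptional null sets can be united. This lets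
the chosen version `rnDeriv` be replaced by an explicit one. -/
theorem IsRNDeriv.ae_eq {ν : POVM X H} {D D' : X → (H →L[ℂ] H)}
    (h : IsRNDeriv ν μ D) (h' : IsRNDeriv ν μ D') : D =ᵐ[μ] D' := by
  have h1 : ∀ᵐ x ∂μ, ∀ i j, ⟪basis H i, D x (basis H j)⟫_ℂ = ⟪basis H i, D' x (basis H j)⟫_ℂ := by
    rw [ae_all_iff]
    intro i
    rw [ae_all_iff]
    intro j
    exact Integrable.ae_eq_of_forall_setIntegral_eq _ _ (h.2 i j).1 (h'.2 i j).1 fun E hE _ => by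
      rw [← (h.2 i j).2 E hE, ← (h'.2 i j).2 E hE]
  filter_upwards [h1] with x hx
  refine (eq_of_inner_basis_eq (basis H) hx)

variable [IsFiniteMeasure μ]

theorem IsQRV.integrable_apply (hf : IsQRV f) (hC : ∀ᵐ x ∂μ, ‖f x‖ ≤ C) (η : H) :
    Integrable (fun x => f x η) μ := by
  let _ : MeasurableSpace H := borel H
  have : BorelSpace H := ⟨rfl⟩
  have : SecondCountableTopology H := UniformSpace.secondCountable_of_separable H
  have hm : Measurable fun x => f x η := by
    refine measurable_of_hasSum
      (fun i => (hf.measurable_inner (basis H i) η).smul_const (basis H i)) fun x => ?_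
    simpa only [HilbertBasis.repr_apply_apply] using (basis H).hasSum_repr (f x η)
  refine Integrable.of_bound hm.aestronglyMeasurable (C * ‖η‖) ?_
  filter_upwards [hC] with x hx
  exact (f x).le_of_opNorm_le hx η

theorem IsQRV.integrable_inner (hf : IsQRV f) (hC : ∀ᵐ x ∂μ, ‖f x‖ ≤ C) (ξ η : H) :
    Integrable (fun x => ⟪ξ, f x η⟫_ℂ) μ :=
  (hf.integrable_apply hC η).const_inner ξ

/-- The weak integral of a bounded quantum random variable. -/
theorem IsQRV.exists_integral (hf : IsQRV f) (hC : ∀ᵐ x ∂μ, ‖f x‖ ≤ C) :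
    ∃ A : H →L[ℂ] H, (∀ ξ η, ⟪ξ, A η⟫_ℂ = ∫ x, ⟪ξ, f x η⟫_ℂ ∂μ) ∧
      ∀ s : State H, trace (s.op * A) = ∫ x, trace (s.op * f x) ∂μ := by
  -- The integral is taken vector by vector as a Bochner integral in `H`, for which weak
  -- measurability suffices by separability.
  let L : H →ₗ[ℂ] H :=
    { toFun := fun η => ∫ x, f x η ∂μ
      map_add' := fun η η' => by
        simp only [map_add]
        exact integral_add (hf.integrable_apply hC η) (hf.integrable_apply hC η')
      map_smul' := fun c η => by
        simp only [map_smul, RingHom.id_apply]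
        exact integral_smul c _ }
  have hL : ∀ η, ‖L η‖ ≤ (C * μ.real Set.univ) * ‖η‖ := by
    intro η
    have h : ‖∫ x, f x η ∂μ‖ ≤ (C * ‖η‖) * μ.real Set.univ := by
      refine norm_integral_le_of_norm_le_const ?_
      filter_upwards [hC] with x hx
      exact (f x).le_of_opNorm_le hx η
    calc ‖L η‖ ≤ (C * ‖η‖) * μ.real Set.univ := h
      _ = _ := by ring
  have hA : ∀ ξ η, ⟪ξ, L.mkContinuous _ hL η⟫_ℂ = ∫ x, ⟪ξ, f x η⟫_ℂ ∂μ := fun ξ η =>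
    (integral_inner (hf.integrable_apply hC η) ξ).symm
  refine ⟨L.mkContinuous _ hL, hA, fun s => ?_⟩
  obtain ⟨v, hv, h⟩ := s.exists_hasSum_trace
  have h1 := h (L.mkContinuous _ hL)
  simp only [hA] at h1
  -- The trace is a series over the vectors `v j`; the summable bound `C ‖v j‖²` allows it to be
  -- exchanged with the integral.
  refine h1.unique (hasSum_integral_of_dominated_convergence (fun j _ => C * ‖v j‖ ^ 2)
    (fun j => (hf.measurable_inner _ _).aestronglyMeasurable) (fun j => ?_)
    (Filter.Eventually.of_forall fun x => hv.summable.mul_left C) (integrable_const _)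
    (Filter.Eventually.of_forall fun x => h (f x)))
  filter_upwards [hC] with x hx
  calc ‖⟪v j, f x (v j)⟫_ℂ‖ ≤ ‖v j‖ * ‖f x (v j)‖ := norm_inner_le_norm _ _
    _ ≤ ‖v j‖ * (C * ‖v j‖) := by gcongr; exact (f x).le_of_opNorm_le hx _
    _ = C * ‖v j‖ ^ 2 := by ring

/-- A bounded positive quantum random variable is the density of a POVM. -/
theorem IsQRV.exists_povm (hf : IsQRV f) (hC : ∀ᵐ x ∂μ, ‖f x‖ ≤ C) (h0 : ∀ᵐ x ∂μ, 0 ≤ f x) :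
    ∃ τ : POVM X H, HasDensity τ μ f := by
  classical
  choose A hA hAt using fun E : Set X => hf.exists_integral (ae_restrict_of_ae (s := E) hC)
  refine ⟨{
    toFun := fun E => if MeasurableSet E then A E else 0
    not_measurable := fun E hE => if_neg hE
    nonneg := fun E hE => ?_
    hasSum_iUnion := fun E hE hd s => ?_ }, fun s E hE => ?_⟩
  · rw [if_pos hE, nonneg_iff_inner]
    intro ξ
    rw [hA]
    refine integral_nonneg_of_ae (ae_restrict_of_ae ?_)
    filter_upwards [h0] with x hx
    exact nonneg_iff_inner.1 hx ξ
  · simp only [if_pos (hE _), if_pos (MeasurableSet.iUnion hE), hAt]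
    exact hasSum_integral_iUnion hE hd (hf.integrable_trace hC s).integrableOn
  · change trace (s.op * if MeasurableSet E then A E else 0) = _
    rw [if_pos hE, hAt]

theorem HasDensity.inner_eq {τ : POVM X H} (h : HasDensity τ μ f) (hf : IsQRV f)
    (hC : ∀ᵐ x ∂μ, ‖f x‖ ≤ C) {E : Set X} (hE : MeasurableSet E) (ξ η : H) :
    ⟪ξ, τ.toFun E η⟫_ℂ = ∫ x in E, ⟪ξ, f x η⟫_ℂ ∂μ := by
  obtain ⟨A, hA, hAt⟩ := hf.exists_integral (ae_restrict_of_ae (s := E) hC)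
  rw [← hA, eq_of_forall_trace_eq fun s => (h s E hE).trans (hAt s).symm]

/-- A bounded Radon-Nikodým derivative is positive almost everywhere. -/
theorem IsRNDeriv.ae_nonneg {ν : POVM X H} (h : IsRNDeriv ν μ f)
    (hC : ∀ᵐ x ∂μ, ‖f x‖ ≤ C) : ∀ᵐ x ∂μ, 0 ≤ f x := by
  -- The definition controls basis entries only; comparing `ν(E)` with the weak integral of `f`
  -- extends the formula to all vectors.
  have h1 : ∀ E, MeasurableSet E → ∀ ξ η, ⟪ξ, ν.toFun E η⟫_ℂ = ∫ x in E, ⟪ξ, f x η⟫_ℂ ∂μ := by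
    intro E hE ξ η
    obtain ⟨A, hA, -⟩ := h.1.exists_integral (ae_restrict_of_ae (s := E) hC)
    rw [← hA, eq_of_inner_basis_eq (basis H) (A := ν.toFun E) (B := A) fun i j => by
      rw [hA, (h.2 i j).2 E hE]]
  have h2 : ∀ᵐ x ∂μ, ∀ n, 0 ≤ ⟪TopologicalSpace.denseSeq H n,
      f x (TopologicalSpace.denseSeq H n)⟫_ℂ := by
    rw [ae_all_iff]
    refine fun n => ae_nonneg_of_forall_setIntegral_nonneg_complex
      (h.1.integrable_inner hC _ _) fun E hE => ?_
    rw [← h1 E hE]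
    exact nonneg_iff_inner.1 (ν.nonneg E hE) _
  filter_upwards [h2] with x hx
  rw [nonneg_iff_inner]
  intro ξ
  exact (TopologicalSpace.denseRange_denseSeq H).induction_on
    (p := fun ξ => 0 ≤ ⟪ξ, f x ξ⟫_ℂ) ξ (isClosed_le (by fun_prop) (by fun_prop)) hx

/-- Since `τ.stateMeasure σ = h μ` with `h = tr (σ f)`, the density relative to it is `h⁻¹ f`.
Invertibility of `f` confines the junk value `0⁻¹ = 0` to a null set. -/
theorem HasDensity.isRNDeriv {τ : POVM X H} (h : HasDensity τ μ f) (hf : IsQRV f)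
    (hC : ∀ᵐ x ∂μ, ‖f x‖ ≤ C) (h0 : ∀ᵐ x ∂μ, 0 ≤ f x) (hu : ∀ᵐ x ∂μ, IsUnit (f x))
    (σ : State H) :
    IsRNDeriv τ (τ.stateMeasure σ) fun x => ((scalarDensity σ f x : ℝ) : ℂ)⁻¹ • f x := by
  have hm := hf.measurable_scalarDensity σ
  have hq : IsQRV fun x => ((scalarDensity σ f x : ℝ) : ℂ)⁻¹ • f x :=
    hf.fun_smul (Complex.measurable_ofReal.comp (measurable_coe_nnreal_real.comp hm)).inv
  have hae : ∀ i j, (fun x => scalarDensity σ f x • ⟪basis H i,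
      (((scalarDensity σ f x : ℝ) : ℂ)⁻¹ • f x) (basis H j)⟫_ℂ) =ᵐ[μ]
        fun x => ⟪basis H i, f x (basis H j)⟫_ℂ := by
    intro i j
    filter_upwards [ae_scalarDensity_ne_zero h0 hu σ] with x hx
    have hx' : ((scalarDensity σ f x : ℝ) : ℂ) ≠ 0 := by exact_mod_cast hx
    rw [smul_apply, inner_smul_right, NNReal.smul_def, Complex.real_smul,
      mul_inv_cancel_left₀ hx']
  rw [h.stateMeasure_eq hf hC h0 σ]
  refine ⟨hq, fun i j => ⟨?_, fun E hE => ?_⟩⟩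
  · rw [integrable_withDensity_iff_integrable_smul hm]
    exact (hf.integrable_inner hC _ _).congr (hae i j).symm
  · rw [setIntegral_withDensity_eq_setIntegral_smul hm _ hE, h.inner_eq hf hC hE]
    exact integral_congr_ae (ae_restrict_of_ae (hae i j).symm)

end Hilbert

end OperatorMeasures

/-! ### Square roots of rescaled operators and positive block matrices -/

section Blocks

variable {H : Type*} [NormedAddCommGroup H] [InnerProductSpace ℂ H] [CompleteSpace H]
variable {K : Type*} [NormedAddCommGroup K] [InnerProductSpace ℂ K] [CompleteSpace K]

theorem ofReal_smul_nonneg {A : H →L[ℂ] H} (hA : 0 ≤ A) {c : ℝ} (hc : 0 ≤ c) :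
    0 ≤ (c : ℂ) • A := by
  rw [Complex.coe_smul]
  exact smul_nonneg hc hA

theorem ofReal_smul_one_eq_algebraMap {H : Type*} [NormedAddCommGroup H] [InnerProductSpace ℂ H]
    (c : ℝ) :
    (c : ℂ) • (1 : H →L[ℂ] H) = algebraMap ℝ (H →L[ℂ] H) c := by
  rw [Algebra.algebraMap_eq_smul_one, Complex.coe_smul]

/-- Uniqueness of the positive square root. At `h = 0` both sides vanish. -/
theorem sqrt_inv_smul {A R : H →L[ℂ] H} (hR : 0 ≤ R) (hRR : R * R = A) (h : NNReal) :
    CFC.sqrt (((h : ℝ) : ℂ)⁻¹ • A) = (((Real.sqrt h)⁻¹ : ℝ) : ℂ) • R := by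
  refine CFC.sqrt_unique ?_ (ofReal_smul_nonneg hR (by positivity))
  rw [smul_mul_smul_comm, hRR, ← Complex.ofReal_mul, ← mul_inv,
    Real.mul_self_sqrt h.coe_nonneg, Complex.ofReal_inv]

theorem sqrt_inv_smul_mul_mul {A R : H →L[ℂ] H} (hR : 0 ≤ R) (hRR : R * R = A) (h : NNReal)
    (B : H →L[ℂ] H) : CFC.sqrt (((h : ℝ) : ℂ)⁻¹ • A) * B * CFC.sqrt (((h : ℝ) : ℂ)⁻¹ • A) =
      ((h : ℝ) : ℂ)⁻¹ • (R * B * R) := by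
  rw [sqrt_inv_smul hR hRR, smul_mul_assoc, smul_mul_smul_comm, ← Complex.ofReal_mul, ← mul_inv,
    Real.mul_self_sqrt h.coe_nonneg, Complex.ofReal_inv]

/-- Cauchy–Schwarz and `2 ‖ξ‖ ‖η‖ ≤ ‖ξ‖² + ‖η‖²`. It provides an admissible pair in the infimum
defining `decNorm`. -/
theorem blockNonneg_norm (f : H →L[ℂ] H) :
    BlockNonneg (((‖f‖ : ℝ) : ℂ) • 1) f (((‖f‖ : ℝ) : ℂ) • 1) := by
  intro ξ η
  have e : ⟪η, ContinuousLinearMap.adjoint f ξ⟫_ℂ = starRingEnd ℂ ⟪ξ, f η⟫_ℂ := by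
    rw [ContinuousLinearMap.adjoint_inner_right, inner_conj_symm]
  have h : ‖⟪ξ, f η⟫_ℂ‖ ≤ ‖ξ‖ * (‖f‖ * ‖η‖) :=
    (norm_inner_le_norm _ _).trans (by gcongr; exact f.le_opNorm η)
  have h2 := (abs_le.1 ((Complex.abs_re_le_norm _).trans h)).1
  rw [e, add_assoc _ ⟪ξ, f η⟫_ℂ, Complex.add_conj]
  simp only [smul_apply, one_apply_eq_self, inner_smul_right,
    inner_self_eq_ofReal]
  norm_cast
  nlinarith [mul_nonneg (norm_nonneg f) (sq_nonneg (‖ξ‖ - ‖η‖))]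

/-- The form at `(w, z)` is the sum over `j` of the original form at the `j`-th slices of `w` and
`z`. -/
theorem BlockNonneg.opTensor_one {S₁ f S₂ : H →L[ℂ] H} (h : BlockNonneg S₁ f S₂) :
    BlockNonneg (opTensor S₁ (1 : K →L[ℂ] K)) (opTensor f 1) (opTensor S₂ 1) := by
  intro w z
  have e : ContinuousLinearMap.adjoint (opTensor f (1 : K →L[ℂ] K)) =
      opTensor (ContinuousLinearMap.adjoint f) 1 := by
    rw [adjoint_opTensor, ← ContinuousLinearMap.star_eq_adjoint (1 : K →L[ℂ] K), star_one]
  rw [e]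
  exact (((hasSum_inner_opTensor_one S₁ w w).add (hasSum_inner_opTensor_one f w z)).add
    (hasSum_inner_opTensor_one _ z w)).add (hasSum_inner_opTensor_one S₂ z z) |>.nonneg
      fun j => h _ _

/-- If `[[S₁, f], [f*, S₂]] ≥ 0` then `[[S₁ ⊗ ‖g‖, f ⊗ g], [(f ⊗ g)*, S₂ ⊗ ‖g‖]] ≥ 0`. -/
theorem BlockNonneg.opTensor {S₁ f S₂ : H →L[ℂ] H} (h : BlockNonneg S₁ f S₂) (h₂ : 0 ≤ S₂)
    (g : K →L[ℂ] K) :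
    BlockNonneg (QRV.opTensor S₁ (((‖g‖ : ℝ) : ℂ) • (1 : K →L[ℂ] K))) (QRV.opTensor f g)
      (QRV.opTensor S₂ (((‖g‖ : ℝ) : ℂ) • (1 : K →L[ℂ] K))) := by
  rcases eq_or_ne g 0 with rfl | hg
  · intro w z
    simp [opTensor_zero_right]
  intro w z
  have hc : 0 < ‖g‖ := norm_pos_iff.2 hg
  set c := ‖g‖ with hcdef
  have ha : 0 < Real.sqrt c := Real.sqrt_pos.2 hc
  set a := Real.sqrt c with hadef
  have haa : a * a = c := Real.mul_self_sqrt hc.le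
  have haC : (a : ℂ) ≠ 0 := by exact_mod_cast ha.ne'
  have haaC : (a : ℂ) * a = c := by exact_mod_cast haa
  have hcC : (c : ℂ) ≠ 0 := by exact_mod_cast hc.ne'
  have e1 : QRV.opTensor f g = QRV.opTensor f (1 : K →L[ℂ] K) * QRV.opTensor 1 g := by
    rw [← opTensor_mul, mul_one, one_mul]
  -- Inserting `(1 ⊗ g) z` turns `f ⊗ 1` into `f ⊗ g`. The scaling by `a = √‖g‖` and its inverse
  -- leaves the cross terms alone and balances the diagonal: `‖g‖ S₁ ⊗ 1` against `‖g‖⁻¹ S₂ ⊗ g*g ≤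
  -- ‖g‖ S₂ ⊗ 1`.
  have h1 := h.opTensor_one (K := K) ((a : ℂ) • w) ((a : ℂ)⁻¹ • QRV.opTensor 1 g z)
  simp only [map_smul, inner_smul_left, inner_smul_right, Complex.conj_ofReal, map_inv₀] at h1
  have t1 : ⟪QRV.opTensor 1 g z, QRV.opTensor S₂ 1 (QRV.opTensor 1 g z)⟫_ℂ =
      ⟪z, QRV.opTensor S₂ (star g * g) z⟫_ℂ := by
    have e2 : QRV.opTensor S₂ (star g * g) =
        ContinuousLinearMap.adjoint (QRV.opTensor (1 : H →L[ℂ] H) g) *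
          (QRV.opTensor S₂ 1 * QRV.opTensor 1 g) := by
      rw [adjoint_opTensor, ← opTensor_mul, ← opTensor_mul, mul_one, one_mul,
        ← ContinuousLinearMap.star_eq_adjoint, ← ContinuousLinearMap.star_eq_adjoint, star_one,
        one_mul]
    rw [e2, mul_apply_eq_comp, mul_apply_eq_comp, ContinuousLinearMap.adjoint_inner_right]
  have t2 : ⟪z, QRV.opTensor S₂ (star g * g) z⟫_ℂ ≤
      (c : ℂ) * ((c : ℂ) * ⟪z, QRV.opTensor S₂ (1 : K →L[ℂ] K) z⟫_ℂ) := by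
    have h3 : star g * g ≤ ((c ^ 2 : ℝ) : ℂ) • (1 : K →L[ℂ] K) := by
      rw [ofReal_smul_one_eq_algebraMap]
      exact CStarAlgebra.star_mul_le_algebraMap_norm_sq
    have h4 := nonneg_iff_inner.1 (sub_nonneg.2 (opTensor_mono_right h₂ h3)) z
    rw [sub_apply, inner_sub_right, sub_nonneg, opTensor_smul_right, smul_apply,
      inner_smul_right] at h4
    refine h4.trans_eq ?_
    push_cast
    ring
  have t3 : (a : ℂ)⁻¹ * ((a : ℂ)⁻¹ * ⟪z, QRV.opTensor S₂ (star g * g) z⟫_ℂ) ≤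
      (c : ℂ) * ⟪z, QRV.opTensor S₂ (1 : K →L[ℂ] K) z⟫_ℂ := by
    have hpos : (0 : ℂ) ≤ ((c⁻¹ : ℝ) : ℂ) := by exact_mod_cast (inv_pos.2 hc).le
    have h5 := mul_le_mul_of_nonneg_left t2 hpos
    rw [← mul_assoc, ← mul_inv, haaC]
    rw [Complex.ofReal_inv, inv_mul_cancel_left₀ hcC] at h5
    exact h5
  have e3 : ContinuousLinearMap.adjoint (QRV.opTensor f g) =
      ContinuousLinearMap.adjoint (QRV.opTensor (1 : H →L[ℂ] H) g) *
        ContinuousLinearMap.adjoint (QRV.opTensor f (1 : K →L[ℂ] K)) := by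
    rw [e1, ← ContinuousLinearMap.star_eq_adjoint, star_mul]
    rfl
  rw [t1] at h1
  rw [e3, e1, mul_apply_eq_comp, mul_apply_eq_comp,
    ContinuousLinearMap.adjoint_inner_right (QRV.opTensor (1 : H →L[ℂ] H) g),
    opTensor_smul_right, opTensor_smul_right, smul_apply, smul_apply, inner_smul_right,
    inner_smul_right]
  refine h1.trans ?_
  rw [← mul_assoc, haaC, mul_inv_cancel_left₀ haC, inv_mul_cancel_left₀ haC]
  exact add_le_add_right t3 _

end Blocks

/-! ### Infima over decompositions and invariance under null sets -/

section Seminorms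

/-- Nonemptiness matters when `C = 0`: an empty infimum is `∞`, and `0 * ∞ = 0`. -/
theorem le_const_mul_biInf {ι : Type*} {P : Set ι} (hP : P.Nonempty) {v : ι → ℝ≥0∞}
    {L C : ℝ≥0∞} (hC : C ≠ ∞) (h : ∀ i ∈ P, L ≤ C * v i) : L ≤ C * ⨅ i ∈ P, v i := by
  rcases eq_or_ne C 0 with rfl | h0
  · obtain ⟨i, hi⟩ := hP
    simpa using h i hi
  · simp only [ENNReal.mul_iInf_of_ne h0 hC]
    exact le_iInf₂ h

variable {X : Type*} [MeasurableSpace X]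
variable {H : Type*} [NormedAddCommGroup H] [InnerProductSpace ℂ H] [CompleteSpace H]

theorem MemLinfOp.ae_norm_le {ν : POVM X H} {ρ : State H} {g : X → (H →L[ℂ] H)}
    (hg : MemLinfOp ν ρ g) : ∀ᵐ x ∂(ν.stateMeasure ρ), ‖g x‖ ≤ (supNorm ν ρ g).toReal := by
  filter_upwards [ENNReal.ae_le_essSup (μ := ν.stateMeasure ρ) fun x => ‖g x‖ₑ] with x hx
  have h := ENNReal.toReal_mono hg.2.ne hx
  rwa [toReal_enorm] at h

theorem slice_eq_of_rnDeriv_eq {ν : POVM X H} {ρ : State H} (s : State H) (f : X → (H →L[ℂ] H))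
    {x : X} {A R : H →L[ℂ] H} {h : NNReal}
    (hx : rnDeriv ν (ν.stateMeasure ρ) x = ((h : ℝ) : ℂ)⁻¹ • A) (hR : 0 ≤ R) (hRR : R * R = A) :
    slice ν ρ s f x = ((h : ℝ) : ℂ)⁻¹ * trace (s.op * (R * f x * R)) := by
  rw [slice, hx, sqrt_inv_smul_mul_mul hR hRR, s.trace_mul_smul]

variable [TopologicalSpace.SeparableSpace H]

theorem nonempty_Pos {f : X → (H →L[ℂ] H)} (hf : IsQRV f) : (Pos f).Nonempty := by
  obtain ⟨G, -, hG, hG0, e, -⟩ := hf.exists_decomp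
  exact ⟨G, fun k => ⟨mem_qrvSpan_iff.2 (hG k), hG0 k⟩, e⟩

/-- The seminorms do not see null sets. -/
theorem pNorm_le_of_ae_eq (ν : POVM X H) (ρ : State H) (p : ℝ≥0∞) {f f' : X → (H →L[ℂ] H)}
    (hf : IsQRV f) (hf' : IsQRV f') (h : f =ᵐ[ν.stateMeasure ρ] f') :
    pNorm ν ρ p f ≤ pNorm ν ρ p f' := by
  -- `Pos` asks for an identity at every point, so a decomposition of `f'` must be corrected by one
  -- of `f - f'`. The total of the correction is at most `2 ‖f - f'‖`, hence zero a.e., and the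
  -- slices do not change.
  obtain ⟨G, c, hG, hG0, e, hc0, hc, hsum⟩ := (hf.sub hf').exists_decomp
  refine le_iInf₂ fun F hF => ?_
  have hFG : F + G ∈ Pos f := by
    refine ⟨fun k => ⟨add_mem (hF.1 k).1 (mem_qrvSpan_iff.2 (hG k)),
      fun x => add_nonneg ((hF.1 k).2 x) (hG0 k x)⟩, ?_⟩
    have h1 : f = f' + (f - f') := by abel
    rw [h1, e]
    nth_rewrite 1 [hF.2]
    simp only [Pi.add_apply]
    module
  refine (iInf₂_le _ hFG).trans (iSup_mono fun s => le_of_eq (eLpNorm_congr_ae ?_))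
  filter_upwards [h] with x hx
  have h0 : (G 0 + G 1 + G 2 + G 3) x = 0 := by
    have h2 := hc x
    rw [Pi.sub_apply, hx, sub_self, norm_zero, mul_zero] at h2
    rw [hsum, le_antisymm h2 (hc0 x), Complex.ofReal_zero, zero_smul]
  have h3 : ((F + G) 0 + (F + G) 1 + (F + G) 2 + (F + G) 3) x = (F 0 + F 1 + F 2 + F 3) x := by
    rw [← add_zero ((F 0 + F 1 + F 2 + F 3) x), ← h0]
    simp only [Pi.add_apply]
    abel
  rw [slice, slice, h3]

end Seminorms

/-! ### The tensor product POVM and the norm estimates -/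

section TensorMeasure

variable {X : Type*} [MeasurableSpace X]
variable {H : Type*} [NormedAddCommGroup H] [InnerProductSpace ℂ H] [CompleteSpace H]
variable {ν : POVM X H} {ρ : State H}

theorem ae_norm_funTensor_rnDeriv_le (hbdd : MemLinfOp ν ρ (rnDeriv ν (ν.stateMeasure ρ))) :
    ∀ᵐ x ∂(ν.stateMeasure ρ),
      ‖funTensor (rnDeriv ν (ν.stateMeasure ρ)) (rnDeriv ν (ν.stateMeasure ρ)) x‖ ≤
        (supNorm ν ρ (rnDeriv ν (ν.stateMeasure ρ))).toReal *
          (supNorm ν ρ (rnDeriv ν (ν.stateMeasure ρ))).toReal := by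
  filter_upwards [hbdd.ae_norm_le] with x hx
  refine (norm_opTensor_le _ _).trans ?_
  gcongr

theorem ae_isUnit_funTensor_rnDeriv
    (hinv : ∀ᵐ x ∂(ν.stateMeasure ρ), IsUnit (rnDeriv ν (ν.stateMeasure ρ) x)) :
    ∀ᵐ x ∂(ν.stateMeasure ρ),
      IsUnit (funTensor (rnDeriv ν (ν.stateMeasure ρ)) (rnDeriv ν (ν.stateMeasure ρ)) x) := by
  filter_upwards [hinv] with x hx
  exact isUnit_opTensor hx hx

theorem IsTensorPOVM.hasDensity {μ : Measure X} {τ : POVM X (HTensor H H)}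
    (hτ : IsTensorPOVM ν ν μ τ) : HasDensity τ μ (funTensor (rnDeriv ν μ) (rnDeriv ν μ)) :=
  fun s E hE => (hτ s).2 E hE

variable [TopologicalSpace.SeparableSpace H]

theorem ae_rnDeriv_nonneg (hν : HasRNDeriv ν (ν.stateMeasure ρ))
    (hbdd : MemLinfOp ν ρ (rnDeriv ν (ν.stateMeasure ρ))) :
    ∀ᵐ x ∂(ν.stateMeasure ρ), 0 ≤ rnDeriv ν (ν.stateMeasure ρ) x :=
  (isRNDeriv_rnDeriv hν).ae_nonneg hbdd.ae_norm_le

theorem ae_funTensor_rnDeriv_nonneg (hν : HasRNDeriv ν (ν.stateMeasure ρ))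
    (hbdd : MemLinfOp ν ρ (rnDeriv ν (ν.stateMeasure ρ))) :
    ∀ᵐ x ∂(ν.stateMeasure ρ),
      0 ≤ funTensor (rnDeriv ν (ν.stateMeasure ρ)) (rnDeriv ν (ν.stateMeasure ρ)) x := by
  filter_upwards [ae_rnDeriv_nonneg hν hbdd] with x hx
  exact opTensor_nonneg hx hx

theorem exists_tensorPOVM (hν : HasRNDeriv ν (ν.stateMeasure ρ))
    (hbdd : MemLinfOp ν ρ (rnDeriv ν (ν.stateMeasure ρ))) :
    ∃ τ : POVM X (HTensor H H), IsTensorPOVM ν ν (ν.stateMeasure ρ) τ := by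
  have hq := hbdd.1.funTensor hbdd.1
  have hC := ae_norm_funTensor_rnDeriv_le hbdd
  obtain ⟨τ, hτ⟩ := hq.exists_povm hC (ae_funTensor_rnDeriv_nonneg hν hbdd)
  exact ⟨τ, fun s => ⟨hq.integrable_trace hC s, hτ s⟩⟩

variable {τ : POVM X (HTensor H H)}

theorem IsTensorPOVM.isRNDeriv (hτ : IsTensorPOVM ν ν (ν.stateMeasure ρ) τ)
    (hν : HasRNDeriv ν (ν.stateMeasure ρ))
    (hbdd : MemLinfOp ν ρ (rnDeriv ν (ν.stateMeasure ρ)))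
    (hinv : ∀ᵐ x ∂(ν.stateMeasure ρ), IsUnit (rnDeriv ν (ν.stateMeasure ρ) x))
    (σ : State (HTensor H H)) :
    IsRNDeriv τ (τ.stateMeasure σ) fun x =>
      ((scalarDensity σ (funTensor (rnDeriv ν (ν.stateMeasure ρ))
        (rnDeriv ν (ν.stateMeasure ρ))) x : ℝ) : ℂ)⁻¹ •
        funTensor (rnDeriv ν (ν.stateMeasure ρ)) (rnDeriv ν (ν.stateMeasure ρ)) x :=
  hτ.hasDensity.isRNDeriv (hbdd.1.funTensor hbdd.1) (ae_norm_funTensor_rnDeriv_le hbdd)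
    (ae_funTensor_rnDeriv_nonneg hν hbdd) (ae_isUnit_funTensor_rnDeriv hinv) σ

theorem IsTensorPOVM.stateMeasure_eq (hτ : IsTensorPOVM ν ν (ν.stateMeasure ρ) τ)
    (hν : HasRNDeriv ν (ν.stateMeasure ρ))
    (hbdd : MemLinfOp ν ρ (rnDeriv ν (ν.stateMeasure ρ))) (σ : State (HTensor H H)) :
    τ.stateMeasure σ = (ν.stateMeasure ρ).withDensity fun x =>
      (scalarDensity σ (funTensor (rnDeriv ν (ν.stateMeasure ρ))
        (rnDeriv ν (ν.stateMeasure ρ))) x : ℝ≥0∞) :=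
  hτ.hasDensity.stateMeasure_eq (hbdd.1.funTensor hbdd.1) (ae_norm_funTensor_rnDeriv_le hbdd)
    (ae_funTensor_rnDeriv_nonneg hν hbdd) σ

theorem IsTensorPOVM.absolutelyContinuous (hτ : IsTensorPOVM ν ν (ν.stateMeasure ρ) τ)
    (hν : HasRNDeriv ν (ν.stateMeasure ρ))
    (hbdd : MemLinfOp ν ρ (rnDeriv ν (ν.stateMeasure ρ))) (σ : State (HTensor H H)) :
    τ.stateMeasure σ ≪ ν.stateMeasure ρ := by
  rw [hτ.stateMeasure_eq hν hbdd σ]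
  exact withDensity_absolutelyContinuous _ _

/-- The `L¹` norms of the slices of `F ⊗ G`, as integrals over the base measure. -/
theorem IsTensorPOVM.eLpNorm_slice_funTensor (hτ : IsTensorPOVM ν ν (ν.stateMeasure ρ) τ)
    (hν : HasRNDeriv ν (ν.stateMeasure ρ))
    (hbdd : MemLinfOp ν ρ (rnDeriv ν (ν.stateMeasure ρ)))
    (hinv : ∀ᵐ x ∂(ν.stateMeasure ρ), IsUnit (rnDeriv ν (ν.stateMeasure ρ) x))
    (σ s : State (HTensor H H)) (F G : X → (H →L[ℂ] H)) :
    eLpNorm (slice τ σ s (funTensor F G)) 1 (τ.stateMeasure σ) =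
      ∫⁻ x, ‖trace (s.op * opTensor
        (CFC.sqrt (rnDeriv ν (ν.stateMeasure ρ) x) * F x *
          CFC.sqrt (rnDeriv ν (ν.stateMeasure ρ) x))
        (CFC.sqrt (rnDeriv ν (ν.stateMeasure ρ) x) * G x *
          CFC.sqrt (rnDeriv ν (ν.stateMeasure ρ) x)))‖ₑ ∂(ν.stateMeasure ρ) := by
  have hrn := hτ.isRNDeriv hν hbdd hinv σ
  have hae := (isRNDeriv_rnDeriv ⟨_, hrn⟩).ae_eq hrn
  have hac := hτ.absolutelyContinuous hν hbdd σ
  have hm := (hbdd.1.funTensor hbdd.1).measurable_scalarDensity σ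
  have hne := ae_scalarDensity_ne_zero (ae_funTensor_rnDeriv_nonneg hν hbdd)
    (ae_isUnit_funTensor_rnDeriv hinv) σ
  have hme := hτ.stateMeasure_eq hν hbdd σ
  set D := rnDeriv ν (ν.stateMeasure ρ) with hDdef
  set h := scalarDensity σ (funTensor D D) with hhdef
  -- `√D ⊗ √D` is the positive square root of `D ⊗ D`, and the two factors `h^{-1/2}` combine to
  -- `h⁻¹`.
  have hsl : ∀ᵐ x ∂(τ.stateMeasure σ), ‖slice τ σ s (funTensor F G) x‖ₑ =
      ‖((h x : ℝ) : ℂ)⁻¹ * trace (s.op * opTensor (CFC.sqrt (D x) * F x * CFC.sqrt (D x))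
        (CFC.sqrt (D x) * G x * CFC.sqrt (D x)))‖ₑ := by
    filter_upwards [hae, hac (ae_rnDeriv_nonneg hν hbdd)] with x h1 h2
    rw [slice_eq_of_rnDeriv_eq s _ h1
      (opTensor_nonneg (CFC.sqrt_nonneg (D x)) (CFC.sqrt_nonneg (D x)))
      (by rw [← opTensor_mul, CFC.sqrt_mul_sqrt_self (D x) h2, funTensor]),
      funTensor, ← opTensor_mul, ← opTensor_mul]
  rw [eLpNorm_one_eq_lintegral_enorm, lintegral_congr_ae hsl, hme,
    lintegral_withDensity_eq_lintegral_mul_non_measurable _ hm.coe_nnreal_ennreal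
      (Filter.Eventually.of_forall fun x => ENNReal.coe_lt_top)]
  refine lintegral_congr_ae ?_
  filter_upwards [hne] with x hx
  have e : ((h x : NNReal) : ℝ≥0∞) * ‖((h x : ℝ) : ℂ)⁻¹‖ₑ = 1 := by
    have e2 : ‖((h x : ℝ) : ℂ)⁻¹‖ₑ = (((h x)⁻¹ : NNReal) : ℝ≥0∞) := by
      rw [← ofReal_norm, norm_inv, Complex.norm_real, NNReal.norm_eq,
        ← NNReal.coe_inv, ENNReal.ofReal_coe_nnreal]
    rw [e2, ← ENNReal.coe_mul, mul_inv_cancel₀ hx, ENNReal.coe_one]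
  rw [Pi.mul_apply, enorm_mul, ← mul_assoc, e, one_mul]

/-- The slice estimate: `F ⊗ c` is bounded by `‖c‖_∞ ‖D‖_∞` times `F`. -/
theorem IsTensorPOVM.eLpNorm_slice_funTensor_le (hτ : IsTensorPOVM ν ν (ν.stateMeasure ρ) τ)
    (hν : HasRNDeriv ν (ν.stateMeasure ρ))
    (hbdd : MemLinfOp ν ρ (rnDeriv ν (ν.stateMeasure ρ)))
    (hinv : ∀ᵐ x ∂(ν.stateMeasure ρ), IsUnit (rnDeriv ν (ν.stateMeasure ρ) x))
    (σ s : State (HTensor H H)) {F G : X → (H →L[ℂ] H)} (hF : ∀ x, 0 ≤ F x) {c : X → ℝ}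
    (hc : ∀ x, 0 ≤ c x) (hG : ∀ x, G x = (c x : ℂ) • 1) {M : ℝ≥0∞} (hM : M ≠ ∞)
    (hcM : ∀ᵐ x ∂(ν.stateMeasure ρ), ENNReal.ofReal (c x) ≤ M) :
    eLpNorm (slice τ σ s (funTensor F G)) 1 (τ.stateMeasure σ) ≤
      M * supNorm ν ρ (rnDeriv ν (ν.stateMeasure ρ)) *
        ⨆ t : State H, eLpNorm (slice ν ρ t F) 1 (ν.stateMeasure ρ) := by
  -- The state `t` absorbs the second factor once it has been bounded by a multiple of `1`.
  obtain ⟨t, ht⟩ := s.exists_partialTrace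
  rw [hτ.eLpNorm_slice_funTensor hν hbdd hinv]
  refine le_trans ?_ (mul_le_mul_right (le_iSup
    (fun t : State H => eLpNorm (slice ν ρ t F) 1 (ν.stateMeasure ρ)) t) _)
  rw [eLpNorm_one_eq_lintegral_enorm, ← lintegral_const_mul' _ _ (ENNReal.mul_ne_top hM hbdd.2.ne)]
  refine lintegral_mono_ae ?_
  filter_upwards [hcM, ae_rnDeriv_nonneg hν hbdd, ENNReal.ae_le_essSup
    (μ := ν.stateMeasure ρ) fun x => ‖rnDeriv ν (ν.stateMeasure ρ) x‖ₑ] with x h1 h2 h3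
  have hFx := (CFC.sqrt_nonneg (rnDeriv ν (ν.stateMeasure ρ) x)).isSelfAdjoint.conjugate_nonneg
    (hF x)
  rw [slice, hG, mul_smul_comm, mul_one, smul_mul_assoc, CFC.sqrt_mul_sqrt_self _ h2, ht]
  set D := rnDeriv ν (ν.stateMeasure ρ) x with hDdef
  set A := CFC.sqrt D * F x * CFC.sqrt D with hA
  -- The scalar `G` commutes with `√D`, so the second factor is `c D`; one power of `‖D‖` is lost
  -- here.
  have hle : (c x : ℂ) • D ≤ ((c x * ‖D‖ : ℝ) : ℂ) • (1 : H →L[ℂ] H) := by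
    have h4 : D ≤ ((‖D‖ : ℝ) : ℂ) • (1 : H →L[ℂ] H) := by
      rw [ofReal_smul_one_eq_algebraMap]
      exact h2.isSelfAdjoint.le_algebraMap_norm_self
    have h5 := ofReal_smul_nonneg (sub_nonneg.2 h4) (hc x)
    rw [smul_sub, sub_nonneg, smul_smul, ← Complex.ofReal_mul] at h5
    exact h5
  have hcD : 0 ≤ (c x : ℂ) • D := ofReal_smul_nonneg h2 (hc x)
  have h6 := s.trace_mul_mono (opTensor_mono_right hFx hle)
  rw [opTensor_smul_right _ _ (1 : H →L[ℂ] H), s.trace_mul_smul] at h6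
  have h7 := CStarAlgebra.norm_le_norm_of_nonneg_of_le
    (trace_mul_nonneg s (opTensor_nonneg hFx hcD)) h6
  rw [norm_mul, Complex.norm_real, Real.norm_of_nonneg (mul_nonneg (hc x) (norm_nonneg _))] at h7
  have h8 := ENNReal.ofReal_le_ofReal h7
  rw [ENNReal.ofReal_mul (mul_nonneg (hc x) (norm_nonneg _)), ENNReal.ofReal_mul (hc x),
    ofReal_norm, ofReal_norm, ofReal_norm] at h8
  refine h8.trans ?_
  gcongr
  exact h3

/-- The product of two decompositions into positive parts. -/
theorem exists_mem_Pos_funTensor {f g : X → (H →L[ℂ] H)} {F G : Fin 4 → X → (H →L[ℂ] H)}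
    (hF : F ∈ Pos f) (hG : ∀ k, IsQRV (G k)) (hG0 : ∀ k x, 0 ≤ G k x)
    (hg : g = G 0 - G 1 + Complex.I • G 2 - Complex.I • G 3) :
    ∃ T ∈ Pos (funTensor f g), T 0 + T 1 + T 2 + T 3 =
      funTensor (F 0 + F 1 + F 2 + F 3) (G 0 + G 1 + G 2 + G 3) := by
  have hq : ∀ k l, IsQRV (funTensor (F k) (G l)) := fun k l =>
    (mem_qrvSpan_iff.1 (hF.1 k).1).funTensor (hG l)
  have hp : ∀ k l x, 0 ≤ funTensor (F k) (G l) x := fun k l x =>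
    opTensor_nonneg ((hF.1 k).2 x) (hG0 l x)
  have hq4 : ∀ k₀ l₀ k₁ l₁ k₂ l₂ k₃ l₃, funTensor (F k₀) (G l₀) + funTensor (F k₁) (G l₁) +
      funTensor (F k₂) (G l₂) + funTensor (F k₃) (G l₃) ∈ qrvSpan X (HTensor H H) ∧
      ∀ x, 0 ≤ (funTensor (F k₀) (G l₀) + funTensor (F k₁) (G l₁) +
        funTensor (F k₂) (G l₂) + funTensor (F k₃) (G l₃)) x :=
    fun k₀ l₀ k₁ l₁ k₂ l₂ k₃ l₃ => ⟨mem_qrvSpan_iff.2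
      ((((hq k₀ l₀).add (hq k₁ l₁)).add (hq k₂ l₂)).add (hq k₃ l₃)), fun x =>
        add_nonneg (add_nonneg (add_nonneg (hp k₀ l₀ x) (hp k₁ l₁ x)) (hp k₂ l₂ x)) (hp k₃ l₃ x)⟩
  -- The sixteen products `F k ⊗ G l` are sorted by the product of their coefficients among `1, -1,
  -- i, -i`; for instance `F 2 ⊗ G 3` has `i · (-i) = 1`.
  refine ⟨![
    funTensor (F 0) (G 0) + funTensor (F 1) (G 1) + funTensor (F 2) (G 3) + funTensor (F 3) (G 2),
    funTensor (F 0) (G 1) + funTensor (F 1) (G 0) + funTensor (F 2) (G 2) + funTensor (F 3) (G 3),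
    funTensor (F 0) (G 2) + funTensor (F 1) (G 3) + funTensor (F 2) (G 0) + funTensor (F 3) (G 1),
    funTensor (F 0) (G 3) + funTensor (F 1) (G 2) + funTensor (F 2) (G 1) + funTensor (F 3) (G 0)],
    ⟨?_, ?_⟩, ?_⟩
  · intro k
    fin_cases k <;> exact hq4 _ _ _ _ _ _ _ _
  · have hf := hF.2
    funext x
    rw [hg, hf]
    simp only [Matrix.cons_val, funTensor, Pi.add_apply, Pi.sub_apply, Pi.smul_apply,
      opTensor_add_left, opTensor_add_right, opTensor_sub_left, opTensor_sub_right,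
      opTensor_smul_left, opTensor_smul_right]
    match_scalars <;> simp
  · funext x
    simp only [Matrix.cons_val, funTensor, Pi.add_apply, opTensor_add_left, opTensor_add_right]
    abel

/-- The constant is governed by the scalar total of a chosen decomposition of `g`: at most `2 ‖g‖`
in general, but no doubling when the second factor is itself a positive scalar function. -/
theorem IsTensorPOVM.pNorm_funTensor_le (hτ : IsTensorPOVM ν ν (ν.stateMeasure ρ) τ)
    (hν : HasRNDeriv ν (ν.stateMeasure ρ))
    (hbdd : MemLinfOp ν ρ (rnDeriv ν (ν.stateMeasure ρ)))
    (hinv : ∀ᵐ x ∂(ν.stateMeasure ρ), IsUnit (rnDeriv ν (ν.stateMeasure ρ) x))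
    (σ : State (HTensor H H)) {f g : X → (H →L[ℂ] H)} (hf : IsQRV f)
    {G : Fin 4 → X → (H →L[ℂ] H)} {c : X → ℝ} (hG : ∀ k, IsQRV (G k)) (hG0 : ∀ k x, 0 ≤ G k x)
    (hg : g = G 0 - G 1 + Complex.I • G 2 - Complex.I • G 3) (hc : ∀ x, 0 ≤ c x)
    (hsum : ∀ x, (G 0 + G 1 + G 2 + G 3) x = (c x : ℂ) • (1 : H →L[ℂ] H)) {M : ℝ≥0∞}
    (hM : M ≠ ∞) (hcM : ∀ᵐ x ∂(ν.stateMeasure ρ), ENNReal.ofReal (c x) ≤ M) :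
    pNorm τ σ 1 (funTensor f g) ≤
      M * supNorm ν ρ (rnDeriv ν (ν.stateMeasure ρ)) * pNorm ν ρ 1 f := by
  refine le_const_mul_biInf (nonempty_Pos hf) (ENNReal.mul_ne_top hM hbdd.2.ne) fun F hF => ?_
  obtain ⟨T, hT, hTs⟩ := exists_mem_Pos_funTensor hF hG hG0 hg
  refine (iInf₂_le T hT).trans (iSup_le fun s => ?_)
  rw [hTs]
  exact hτ.eLpNorm_slice_funTensor_le hν hbdd hinv σ s
    (fun x => add_nonneg (add_nonneg (add_nonneg ((hF.1 0).2 x) ((hF.1 1).2 x)) ((hF.1 2).2 x))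
      ((hF.1 3).2 x)) hc hsum hM hcM

theorem IsTensorPOVM.pNorm_funTensor_le_two_mul (hτ : IsTensorPOVM ν ν (ν.stateMeasure ρ) τ)
    (hν : HasRNDeriv ν (ν.stateMeasure ρ))
    (hbdd : MemLinfOp ν ρ (rnDeriv ν (ν.stateMeasure ρ)))
    (hinv : ∀ᵐ x ∂(ν.stateMeasure ρ), IsUnit (rnDeriv ν (ν.stateMeasure ρ) x))
    (σ : State (HTensor H H)) {f g : X → (H →L[ℂ] H)} (hf : IsQRV f) (hg : MemLinfOp ν ρ g) :
    pNorm τ σ 1 (funTensor f g) ≤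
      2 * supNorm ν ρ (rnDeriv ν (ν.stateMeasure ρ)) * pNorm ν ρ 1 f * supNorm ν ρ g := by
  obtain ⟨G, c, hG, hG0, e, hc0, hc, hsum⟩ := hg.1.exists_decomp
  refine (hτ.pNorm_funTensor_le hν hbdd hinv σ hf hG hG0 e hc0 hsum
    (M := 2 * supNorm ν ρ g) (ENNReal.mul_ne_top ENNReal.ofNat_ne_top hg.2.ne) ?_).trans_eq
      (by ring)
  filter_upwards [ENNReal.ae_le_essSup (μ := ν.stateMeasure ρ) fun x => ‖g x‖ₑ] with x hx
  refine (ENNReal.ofReal_le_ofReal (hc x)).trans ?_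
  rw [ENNReal.ofReal_mul zero_le_two, ENNReal.ofReal_ofNat, ofReal_norm]
  gcongr
  exact hx

theorem IsTensorPOVM.pNorm_funTensor_norm_le (hτ : IsTensorPOVM ν ν (ν.stateMeasure ρ) τ)
    (hν : HasRNDeriv ν (ν.stateMeasure ρ))
    (hbdd : MemLinfOp ν ρ (rnDeriv ν (ν.stateMeasure ρ)))
    (hinv : ∀ᵐ x ∂(ν.stateMeasure ρ), IsUnit (rnDeriv ν (ν.stateMeasure ρ) x))
    (σ : State (HTensor H H)) {f g : X → (H →L[ℂ] H)} (hf : IsQRV f) (hg : MemLinfOp ν ρ g) :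
    pNorm τ σ 1 (funTensor f fun x => ((‖g x‖ : ℝ) : ℂ) • (1 : H →L[ℂ] H)) ≤
      supNorm ν ρ g * supNorm ν ρ (rnDeriv ν (ν.stateMeasure ρ)) * pNorm ν ρ 1 f := by
  have hn : IsQRV fun x => ((‖g x‖ : ℝ) : ℂ) • (1 : H →L[ℂ] H) :=
    (isQRV_const 1).fun_smul (Complex.measurable_ofReal.comp hg.1.measurable_norm)
  have h0 : IsQRV (0 : X → (H →L[ℂ] H)) := isQRV_const 0
  refine hτ.pNorm_funTensor_le hν hbdd hinv σ hf
    (G := ![fun x => ((‖g x‖ : ℝ) : ℂ) • (1 : H →L[ℂ] H), 0, 0, 0]) (c := fun x => ‖g x‖)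
    (fun k => ?_) (fun k x => ?_) ?_ (fun x => norm_nonneg _) (fun x => ?_) hg.2.ne ?_
  · fin_cases k
    exacts [hn, h0, h0, h0]
  · fin_cases k
    exacts [ofReal_smul_nonneg zero_le_one (norm_nonneg _), le_rfl, le_rfl, le_rfl]
  · simp
  · simp
  · simp only [ofReal_norm]
    exact ENNReal.ae_le_essSup _

theorem IsTensorPOVM.decNorm_funTensor_le (hτ : IsTensorPOVM ν ν (ν.stateMeasure ρ) τ)
    (hν : HasRNDeriv ν (ν.stateMeasure ρ))
    (hbdd : MemLinfOp ν ρ (rnDeriv ν (ν.stateMeasure ρ)))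
    (hinv : ∀ᵐ x ∂(ν.stateMeasure ρ), IsUnit (rnDeriv ν (ν.stateMeasure ρ) x))
    (σ : State (HTensor H H)) {f g : X → (H →L[ℂ] H)} (hf : IsQRV f) (hg : MemLinfOp ν ρ g) :
    decNorm τ σ 1 (funTensor f g) ≤
      supNorm ν ρ (rnDeriv ν (ν.stateMeasure ρ)) * decNorm ν ρ 1 f * supNorm ν ρ g := by
  have hn : ∀ {k : X → (H →L[ℂ] H)}, IsQRV k →
      IsQRV fun x => ((‖k x‖ : ℝ) : ℂ) • (1 : H →L[ℂ] H) := fun hk =>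
    (isQRV_const 1).fun_smul (Complex.measurable_ofReal.comp hk.measurable_norm)
  have hnn : ∀ (k : X → (H →L[ℂ] H)) x, 0 ≤ ((‖k x‖ : ℝ) : ℂ) • (1 : H →L[ℂ] H) :=
    fun k x => ofReal_smul_nonneg zero_le_one (norm_nonneg _)
  suffices h : decNorm τ σ 1 (funTensor f g) ≤
      (supNorm ν ρ g * supNorm ν ρ (rnDeriv ν (ν.stateMeasure ρ))) * decNorm ν ρ 1 f from
    h.trans_eq (by ring)
  refine le_const_mul_biInf ?_ (ENNReal.mul_ne_top hg.2.ne hbdd.2.ne) ?_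
  · exact ⟨(fun x => ((‖f x‖ : ℝ) : ℂ) • 1, fun x => ((‖f x‖ : ℝ) : ℂ) • 1),
      ⟨mem_qrvSpan_iff.2 (hn hf), hnn f⟩, ⟨mem_qrvSpan_iff.2 (hn hf), hnn f⟩,
      Filter.Eventually.of_forall fun x => blockNonneg_norm (f x)⟩
  rintro ⟨S₁, S₂⟩ ⟨⟨h1, h1'⟩, ⟨h2, h2'⟩, hS⟩
  dsimp only at h1 h1' h2 h2' hS ⊢
  have hT : ∀ S : X → (H →L[ℂ] H), S ∈ qrvSpan X H → (∀ x, 0 ≤ S x) →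
      (funTensor S fun x => ((‖g x‖ : ℝ) : ℂ) • (1 : H →L[ℂ] H)) ∈ qrvSpan X (HTensor H H) ∧
      ∀ x, 0 ≤ funTensor S (fun x => ((‖g x‖ : ℝ) : ℂ) • (1 : H →L[ℂ] H)) x := fun S hS hS0 =>
    ⟨mem_qrvSpan_iff.2 ((mem_qrvSpan_iff.1 hS).funTensor (hn hg.1)),
      fun x => opTensor_nonneg (hS0 x) (hnn g x)⟩
  have hB : ∀ᵐ x ∂(τ.stateMeasure σ), BlockNonneg
      (funTensor S₁ (fun x => ((‖g x‖ : ℝ) : ℂ) • (1 : H →L[ℂ] H)) x) (funTensor f g x)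
      (funTensor S₂ (fun x => ((‖g x‖ : ℝ) : ℂ) • (1 : H →L[ℂ] H)) x) := by
    -- The block condition for `f` holds `ν_ρ`-a.e.; absolute continuity transfers it to the measure
    -- of `τ`.
    filter_upwards [hτ.absolutelyContinuous hν hbdd σ hS] with x hx
    exact BlockNonneg.opTensor hx (h2' x) (g x)
  refine le_trans (iInf₂_le (_, _) (And.intro (hT S₁ h1 h1') (And.intro (hT S₂ h2 h2') hB)))
    (max_le ?_ ?_)
  · exact (hτ.pNorm_funTensor_norm_le hν hbdd hinv σ (mem_qrvSpan_iff.1 h1) hg).trans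
      (mul_le_mul_right (le_max_left _ _) _)
  · exact (hτ.pNorm_funTensor_norm_le hν hbdd hinv σ (mem_qrvSpan_iff.1 h2) hg).trans
      (mul_le_mul_right (le_max_right _ _) _)

end TensorMeasure

end QRV

end

/-! ### The theorem -/

theorem mainTheorem7
    {X : Type*} [TopologicalSpace X] [LocallyCompactSpace X] [T2Space X]
    [MeasurableSpace X] [BorelSpace X]
    {H : Type*} [NormedAddCommGroup H] [InnerProductSpace ℂ H] [CompleteSpace H]
    [TopologicalSpace.SeparableSpace H]
    (ν : QRV.POVM X H) (ρ : QRV.State H) (hρ : ρ.FullRank)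
    (hν : QRV.HasRNDeriv ν (ν.stateMeasure ρ))
    (hbdd : QRV.MemLinfOp ν ρ (QRV.rnDeriv ν (ν.stateMeasure ρ)))
    (hinv : ∀ᵐ x ∂(ν.stateMeasure ρ), IsUnit (QRV.rnDeriv ν (ν.stateMeasure ρ) x)) :
    (∃ τ : QRV.POVM X (QRV.HTensor H H), QRV.IsTensorPOVM ν ν (ν.stateMeasure ρ) τ) ∧
    ∀ τ : QRV.POVM X (QRV.HTensor H H), QRV.IsTensorPOVM ν ν (ν.stateMeasure ρ) τ →
      ∀ σ : QRV.State (QRV.HTensor H H), σ.FullRank →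
        QRV.HasRNDeriv τ (τ.stateMeasure σ) ∧
        (∀ f g : X → (H →L[ℂ] H), QRV.MemLpOp ν ρ 1 f → QRV.MemLinfOp ν ρ g →
          QRV.MemLpOp τ σ 1 (QRV.funTensor f g) ∧
          QRV.pNorm τ σ 1 (QRV.funTensor f g) ≤
            2 * QRV.supNorm ν ρ (QRV.rnDeriv ν (ν.stateMeasure ρ)) *
              QRV.pNorm ν ρ 1 f * QRV.supNorm ν ρ g ∧
          QRV.decNorm τ σ 1 (QRV.funTensor f g) ≤
            QRV.supNorm ν ρ (QRV.rnDeriv ν (ν.stateMeasure ρ)) *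
              QRV.decNorm ν ρ 1 f * QRV.supNorm ν ρ g) ∧
        -- the class of `f ⊗ g` depends only on the classes of `f` and `g`
        (∀ f f' g g' : X → (H →L[ℂ] H),
          QRV.MemLpOp ν ρ 1 f → QRV.MemLpOp ν ρ 1 f' →
          QRV.MemLinfOp ν ρ g → QRV.MemLinfOp ν ρ g' →
          QRV.pNorm ν ρ 1 (f - f') = 0 → g =ᵐ[ν.stateMeasure ρ] g' →
          QRV.pNorm τ σ 1 (QRV.funTensor f g - QRV.funTensor f' g') = 0) := by
  refine ⟨QRV.exists_tensorPOVM hν hbdd, fun τ hτ σ _ => ⟨⟨_, hτ.isRNDeriv hν hbdd hinv σ⟩, ?_, ?_⟩⟩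
  · intro f g hf hg
    have hfq := QRV.mem_qrvSpan_iff.1 hf.1
    have h := hτ.pNorm_funTensor_le_two_mul hν hbdd hinv σ hfq hg
    refine ⟨⟨QRV.mem_qrvSpan_iff.2 (hfq.funTensor hg.1), h.trans_lt ?_⟩, h,
      hτ.decNorm_funTensor_le hν hbdd hinv σ hfq hg⟩
    exact ENNReal.mul_lt_top (ENNReal.mul_lt_top
      (ENNReal.mul_lt_top ENNReal.ofNat_lt_top hbdd.2) hf.2) hg.2
  · intro f f' g g' hf hf' hg hg' hff hgg
    have hfq := QRV.mem_qrvSpan_iff.1 hf.1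
    have hfq' := QRV.mem_qrvSpan_iff.1 hf'.1
    -- Replacing `g'` by `g` off a null set leaves `(f - f') ⊗ g`, whose norm is bounded by a
    -- multiple of `‖f - f'‖₁ = 0`.
    have hae : QRV.funTensor f g - QRV.funTensor f' g' =ᵐ[τ.stateMeasure σ]
        QRV.funTensor (f - f') g := by
      filter_upwards [hτ.absolutelyContinuous hν hbdd σ hgg] with x hx
      simp only [Pi.sub_apply, QRV.funTensor, QRV.opTensor_sub_left, hx]
    have h1 := QRV.pNorm_le_of_ae_eq τ σ 1
      ((hfq.funTensor hg.1).sub (hfq'.funTensor hg'.1)) ((hfq.sub hfq').funTensor hg.1) hae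
    have h2 := hτ.pNorm_funTensor_le_two_mul hν hbdd hinv σ (hfq.sub hfq') hg
    rw [hff, mul_zero, zero_mul] at h2
    exact le_antisymm (h1.trans h2) zero_le
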